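/- Let $d\ge 2$ be an integer. On $L^2(\mathbb R)$ (complex-valued functions) let $Tf(x)=f(x-1)$ and $Df(x)=\sqrt d\,f(dx)$. A wavelet for dilation $d$ is a function $\psi\in L^2(\mathbb R)$ such that $\{D^mT^l\psi : m,l\in\mathbb Z\}=\{d^{m/2}\psi(d^m x-l) : m,l\in\mathbb Z\}$ is an orthonormal basis of $L^2(\mathbb R)$. For such $\psi$ and $j\in\mathbb Z$ let $V_j$ be the closed linear span of $\{D^mT^l\psi : m<j,\ l\in\mathbb Z\}$. For an integer $n\ge 0$ let $\mathcal L_n$ be the set of wavelets for dilation $d$ such that $V_{-n}$ is invariant under all integer translations $T^l$, $l\in\mathbb Z$, and let $\mathcal M_n=\mathcal L_n\setminus\mathcal L_{n+1}$. A wavelet has the translation invariance property of order $n$ if, for every $j\in\mathbb Z$, $V_j$ is invariant under all integer translations if and only if $j\ge -n$. Theorem. For every integer dilation factor $d\ge 2$ and every integer $n\ge 1$, there exists a wavelet $\psi$ for dilation $d$ that belongs to $\mathcal M_n$ and has the translation invariance property of order $n$. In particular $\mathcal M_n$ is non-empty. -/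

import Mathlib

open MeasureTheory

noncomputable section

/-- The Hilbert space `L²(ℝ)` of complex-valued square integrable functions. -/
abbrev L2R : Type := Lp ℂ 2 (volume : Measure ℝ)

/-- `f ↦ f (· - t)` on `L²(ℝ)`, as a linear isometry. -/
def translationIsom (t : ℝ) : L2R →ₗᵢ[ℂ] L2R :=
  Lp.compMeasurePreservingₗᵢ ℂ (fun x : ℝ => x - t) (measurePreserving_sub_right volume t)

lemma translationIsom_coeFn (t : ℝ) (f : L2R) :
    translationIsom t f =ᵐ[volume] fun x => f (x - t) :=
  Lp.coeFn_compMeasurePreserving f (measurePreserving_sub_right volume t)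

lemma translationIsom_comp (s t : ℝ) (h : s + t = 0) (f : L2R) :
    translationIsom s (translationIsom t f) = f := by
  apply Lp.ext
  refine (translationIsom_coeFn s _).trans ?_
  refine ((measurePreserving_sub_right volume s).quasiMeasurePreserving.ae_eq_comp
    (translationIsom_coeFn t f)).trans ?_
  refine Filter.Eventually.of_forall fun x => ?_
  have : x - s - t = x := by linarith
  simp [this]

/-- The unitary translation operator `T_t f(x) = f(x - t)` on `L²(ℝ)`. -/
def translationBy (t : ℝ) : L2R ≃ₗᵢ[ℂ] L2R where
  toLinearEquiv := LinearEquiv.ofLinearMap (translationIsom t).toLinearMap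
    (translationIsom (-t)).toLinearMap
    (LinearMap.ext fun f => translationIsom_comp t (-t) (by ring) f)
    (LinearMap.ext fun f => translationIsom_comp (-t) t (by ring) f)
  norm_map' f := (translationIsom t).norm_map f

lemma translationBy_coeFn (t : ℝ) (f : L2R) :
    translationBy t f =ᵐ[volume] fun x => f (x - t) :=
  translationIsom_coeFn t f

/-- The translation operator `T f(x) = f(x - 1)`. -/
def translation : L2R ≃ₗᵢ[ℂ] L2R := translationBy 1

lemma quasiMeasurePreserving_mul_left {a : ℝ} (ha : 0 < a) :
    Measure.QuasiMeasurePreserving (fun x : ℝ => a * x) volume volume := by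
  refine ⟨by fun_prop, ?_⟩
  rw [Real.map_volume_mul_left ha.ne']
  exact Measure.smul_absolutelyContinuous

lemma eLpNorm_dilate {a : ℝ} (ha : 0 < a) (f : L2R) :
    eLpNorm (fun x : ℝ => ((√a : ℝ) : ℂ) * f (a * x)) 2 volume = eLpNorm f 2 volume := by
  have hm : eLpNorm (fun x : ℝ => f (a * x)) 2 volume
      = eLpNorm f 2 (Measure.map (fun x : ℝ => a * x) volume) := by
    refine (eLpNorm_map_measure ?_ (by fun_prop)).symm
    rw [Real.map_volume_mul_left ha.ne']
    exact (Lp.aestronglyMeasurable f).smul_measure _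
  have h1 : eLpNorm (fun x : ℝ => ((√a : ℝ) : ℂ) * f (a * x)) 2 volume
      = ‖((√a : ℝ) : ℂ)‖ₑ * eLpNorm (fun x : ℝ => f (a * x)) 2 volume :=
    eLpNorm_const_smul ((√a : ℝ) : ℂ) (fun x : ℝ => f (a * x)) 2 volume
  rw [h1, hm, Real.map_volume_mul_left ha.ne',
    eLpNorm_smul_measure_of_ne_top (by norm_num), smul_eq_mul, ← mul_assoc]
  have h2 : ‖((√a : ℝ) : ℂ)‖ₑ = ENNReal.ofReal (√a) := by
    rw [← ofReal_norm, Complex.norm_real, Real.norm_of_nonneg (Real.sqrt_nonneg a)]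
  have h3 : ENNReal.ofReal |a⁻¹| ^ (1 / (2 : ENNReal).toReal) = ENNReal.ofReal (√a)⁻¹ := by
    rw [abs_of_pos (inv_pos.2 ha), ENNReal.ofReal_rpow_of_pos (inv_pos.2 ha), ← Real.sqrt_inv,
      Real.sqrt_eq_rpow]
    norm_num
  simp only [ENNReal.toReal_div, ENNReal.toReal_one] at *
  rw [h2, h3, ← ENNReal.ofReal_mul (Real.sqrt_nonneg a),
    mul_inv_cancel₀ (Real.sqrt_pos.2 ha).ne', ENNReal.ofReal_one, one_mul]

lemma memLp_dilate {a : ℝ} (ha : 0 < a) (f : L2R) :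
    MemLp (fun x : ℝ => ((√a : ℝ) : ℂ) * f (a * x)) 2 volume := by
  refine ⟨?_, ?_⟩
  · exact ((Lp.aestronglyMeasurable f).comp_quasiMeasurePreserving
      (quasiMeasurePreserving_mul_left ha)).const_mul _
  · rw [eLpNorm_dilate ha]
    exact Lp.eLpNorm_lt_top f

/-- `f ↦ √a f (a ·)` on `L²(ℝ)`, as a linear map. -/
def dilationLin (a : ℝ) (ha : 0 < a) : L2R →ₗ[ℂ] L2R where
  toFun f := (memLp_dilate ha f).toLp _
  map_add' f g := by
    apply Lp.ext
    refine (MemLp.coeFn_toLp _).trans ?_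
    refine Filter.EventuallyEq.trans ?_ (Lp.coeFn_add _ _).symm
    filter_upwards [(quasiMeasurePreserving_mul_left ha).ae_eq_comp (Lp.coeFn_add f g),
      MemLp.coeFn_toLp (memLp_dilate ha f), MemLp.coeFn_toLp (memLp_dilate ha g)] with x h1 h2 h3
    simp only [Function.comp_apply, Pi.add_apply] at h1
    rw [Pi.add_apply, h1, h2, h3, mul_add]
  map_smul' c f := by
    apply Lp.ext
    refine (MemLp.coeFn_toLp _).trans ?_
    refine Filter.EventuallyEq.trans ?_ (Lp.coeFn_smul _ _).symm
    filter_upwards [(quasiMeasurePreserving_mul_left ha).ae_eq_comp (Lp.coeFn_smul c f),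
      MemLp.coeFn_toLp (memLp_dilate ha f)] with x h1 h2
    simp only [Function.comp_apply, Pi.smul_apply, smul_eq_mul] at h1
    simp only [Pi.smul_apply, smul_eq_mul, RingHom.id_apply]
    rw [h1, h2]
    ring

lemma dilationLin_coeFn {a : ℝ} (ha : 0 < a) (f : L2R) :
    dilationLin a ha f =ᵐ[volume] fun x => ((√a : ℝ) : ℂ) * f (a * x) :=
  MemLp.coeFn_toLp (memLp_dilate ha f)

lemma dilationLin_comp {a b : ℝ} (ha : 0 < a) (hb : 0 < b) (h : a * b = 1) (f : L2R) :
    dilationLin a ha (dilationLin b hb f) = f := by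
  apply Lp.ext
  refine (dilationLin_coeFn ha _).trans ?_
  filter_upwards [(quasiMeasurePreserving_mul_left ha).ae_eq_comp (dilationLin_coeFn hb f)]
    with x hx
  simp only [Function.comp_apply] at hx
  rw [hx, ← mul_assoc, ← mul_assoc, ← Complex.ofReal_mul, ← Real.sqrt_mul ha.le, mul_comm b a, h]
  simp

/-- The unitary dilation operator `f ↦ √a f (a ·)` on `L²(ℝ)`, for a real number `a > 0`. -/
def dilationBy (a : ℝ) (ha : 0 < a) : L2R ≃ₗᵢ[ℂ] L2R where
  toLinearEquiv := LinearEquiv.ofLinearMap (dilationLin a ha) (dilationLin a⁻¹ (inv_pos.2 ha))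
    (LinearMap.ext fun f => dilationLin_comp ha (inv_pos.2 ha) (mul_inv_cancel₀ ha.ne') f)
    (LinearMap.ext fun f => dilationLin_comp (inv_pos.2 ha) ha (inv_mul_cancel₀ ha.ne') f)
  norm_map' f := by
    change ‖dilationLin a ha f‖ = ‖f‖
    rw [Lp.norm_def, Lp.norm_def, eLpNorm_congr_ae (dilationLin_coeFn ha f), eLpNorm_dilate ha]

lemma dilationBy_coeFn {a : ℝ} (ha : 0 < a) (f : L2R) :
    dilationBy a ha f =ᵐ[volume] fun x => ((√a : ℝ) : ℂ) * f (a * x) :=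
  dilationLin_coeFn ha f

/-- The dilation operator `D f(x) = √d f(d x)` for an integer dilation factor `d ≥ 2`. -/
def dilation (d : ℕ) (hd : 2 ≤ d) : L2R ≃ₗᵢ[ℂ] L2R :=
  dilationBy d (Nat.cast_pos.2 (Nat.lt_of_lt_of_le Nat.zero_lt_two hd))

lemma translation_zpow_coeFn (l : ℤ) (f : L2R) :
    (translation ^ l) f =ᵐ[volume] fun x => f (x - l) := by
  have hone : ∀ g : L2R, translation⁻¹ g =ᵐ[volume] fun x => g (x + 1) := fun g => by
    refine (translationIsom_coeFn (-1) g).trans (Filter.Eventually.of_forall fun x => ?_)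
    simp only [sub_neg_eq_add]
  induction l using Int.induction_on generalizing f with
  | zero => simp
  | succ i ih =>
    rw [zpow_add_one]
    refine (ih (translation f)).trans ?_
    refine ((measurePreserving_sub_right volume ((i : ℤ) : ℝ)).quasiMeasurePreserving.ae_eq_comp
      (translationBy_coeFn 1 f)).trans (Filter.Eventually.of_forall fun x => ?_)
    simp [sub_sub]
  | pred i ih =>
    rw [zpow_sub_one]
    refine (ih (translation⁻¹ f)).trans ?_
    refine ((measurePreserving_sub_right volume ((-(i : ℤ) : ℤ) : ℝ)).quasiMeasurePreserving.ae_eq_comp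
      (hone f)).trans (Filter.Eventually.of_forall fun x => ?_)
    simp only [Function.comp_apply]
    congr 1
    push_cast
    ring

lemma dilation_zpow_coeFn (d : ℕ) (hd : 2 ≤ d) (n : ℤ) (f : L2R) :
    (dilation d hd ^ n) f =ᵐ[volume]
      fun x => (((√(d : ℝ)) ^ n : ℝ) : ℂ) * f ((d : ℝ) ^ n * x) := by
  have hd0 : (0 : ℝ) < d := Nat.cast_pos.2 (Nat.lt_of_lt_of_le Nat.zero_lt_two hd)
  have hs0 : √(d : ℝ) ≠ 0 := (Real.sqrt_pos.2 hd0).ne'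
  have hone : ∀ g : L2R, (dilation d hd)⁻¹ g =ᵐ[volume]
      fun x => (((√(d : ℝ))⁻¹ : ℝ) : ℂ) * g ((d : ℝ)⁻¹ * x) := fun g => by
    refine (dilationLin_coeFn (inv_pos.2 hd0) g).trans (Filter.Eventually.of_forall fun x => ?_)
    simp only [Real.sqrt_inv]
  induction n using Int.induction_on generalizing f with
  | zero => simp
  | succ i ih =>
    rw [zpow_add_one]
    refine (ih (dilation d hd f)).trans ?_
    filter_upwards [(quasiMeasurePreserving_mul_left (zpow_pos hd0 (i : ℤ))).ae_eq_comp
      (dilationBy_coeFn hd0 f)] with x hx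
    simp only [Function.comp_apply] at hx
    change _ * (dilationBy (d : ℝ) hd0 f) _ = _
    rw [hx, zpow_add_one₀ hs0, zpow_add_one₀ hd0.ne', Complex.ofReal_mul, mul_assoc, ← mul_assoc,
      mul_comm ((d : ℝ) ^ (i : ℤ)) (d : ℝ), mul_assoc (d : ℝ), mul_assoc]
  | pred i ih =>
    rw [zpow_sub_one]
    refine (ih ((dilation d hd)⁻¹ f)).trans ?_
    filter_upwards [(quasiMeasurePreserving_mul_left (zpow_pos hd0 (-(i : ℤ)))).ae_eq_comp
      (hone f)] with x hx
    simp only [Function.comp_apply] at hx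
    rw [hx, zpow_sub_one₀ hs0, zpow_sub_one₀ hd0.ne', Complex.ofReal_mul, mul_assoc,
      mul_comm ((d : ℝ) ^ (-(i : ℤ))) (d : ℝ)⁻¹, mul_assoc (d : ℝ)⁻¹]

/-- The function `Dⁿ Tˡ ψ`, i.e. `x ↦ d^{n/2} ψ(dⁿ x - l)`, for integers `n`, `l`. -/
def affineSystem (d : ℕ) (hd : 2 ≤ d) (ψ : L2R) (p : ℤ × ℤ) : L2R :=
  (dilation d hd ^ p.1) ((translation ^ p.2) ψ)

/-- The element `Dⁿ Tˡ ψ` is the function `x ↦ d^{n/2} ψ(dⁿ x - l)`. -/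
lemma affineSystem_coeFn (d : ℕ) (hd : 2 ≤ d) (ψ : L2R) (n l : ℤ) :
    affineSystem d hd ψ (n, l) =ᵐ[volume]
      fun x => (((d : ℝ) ^ ((n : ℝ) / 2) : ℝ) : ℂ) * ψ ((d : ℝ) ^ n * x - l) := by
  have hd0 : (0 : ℝ) < d := Nat.cast_pos.2 (Nat.lt_of_lt_of_le Nat.zero_lt_two hd)
  have hc : (√(d : ℝ)) ^ n = (d : ℝ) ^ ((n : ℝ) / 2) := by
    rw [Real.sqrt_eq_rpow, ← Real.rpow_intCast, ← Real.rpow_mul hd0.le]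
    congr 1
    ring
  refine (dilation_zpow_coeFn d hd n _).trans ?_
  filter_upwards [(quasiMeasurePreserving_mul_left (zpow_pos hd0 n)).ae_eq_comp
    (translation_zpow_coeFn l ψ)] with x hx
  simp only [Function.comp_apply] at hx
  rw [hx, hc]

/-- `ψ` is an (orthonormal) wavelet for dilation `d`: the functions `d^{n/2} ψ(dⁿ x - l)`,
`n, l ∈ ℤ`, form an orthonormal basis of `L²(ℝ)`. -/
def IsWavelet (d : ℕ) (hd : 2 ≤ d) (ψ : L2R) : Prop :=
  Orthonormal ℂ (affineSystem d hd ψ) ∧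
    (Submodule.span ℂ (Set.range (affineSystem d hd ψ))).topologicalClosure = ⊤

/-- `V_j`, the closed linear span of `{Dⁿ Tˡ ψ : n < j, l ∈ ℤ}`. -/
def spaceV (d : ℕ) (hd : 2 ≤ d) (ψ : L2R) (j : ℤ) : Submodule ℂ L2R :=
  (Submodule.span ℂ {f | ∃ n l : ℤ, n < j ∧ f = affineSystem d hd ψ (n, l)}).topologicalClosure

/-- A subspace of `L²(ℝ)` is invariant under all integer translations `Tˡ`, `l ∈ ℤ`. -/
def TranslationInvariant (S : Submodule ℂ L2R) : Prop :=
  ∀ l : ℤ, ∀ f ∈ S, (translation ^ l) f ∈ S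

/-- `L_n`: the wavelets for dilation `d` such that `V_{-n}` is invariant under integer
translations. -/
def classL (d : ℕ) (hd : 2 ≤ d) (n : ℕ) : Set L2R :=
  {ψ | IsWavelet d hd ψ ∧ TranslationInvariant (spaceV d hd ψ (-(n : ℤ)))}

/-- `M_n = L_n \ L_{n+1}`. -/
def classM (d : ℕ) (hd : 2 ≤ d) (n : ℕ) : Set L2R :=
  classL d hd n \ classL d hd (n + 1)

/-- The translation invariance property of order `n`: the space `V_j` is invariant under integer
translations if and only if `j ≥ -n`. -/
def HasTranslationInvarianceOrder (d : ℕ) (hd : 2 ≤ d) (n : ℕ) (ψ : L2R) : Prop :=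
  ∀ j : ℤ, TranslationInvariant (spaceV d hd ψ j) ↔ -(n : ℤ) ≤ j

end

noncomputable section

open FourierTransform SchwartzMap Complex

/-! ### Translations and dilations on the Fourier side -/

/-! The proof rotates a wavelet-set wavelet by a unitary operator. On the Fourier side `T^l` is
multiplication by `exp (-2πi l ξ)` and `D` becomes `D⁻¹`. If the integer translates of `W` tile the
line and its `d`-adic dilates tile the line minus the origin, the function `η` with Fourier
transform `1_W` is a wavelet (`IsWaveletSet.isWavelet`), whose `m`-th level consists of the
functions with spectrum in `d^m W`.

Let `σ` be a measure preserving involution of the frequency line that commutes with multiplication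
by `d` and moves points of `W` by integers, and let `S` be composition with `σ`. Then `U = (1 + i S)
/ √2` is unitary, commutes with `D`, and satisfies `U T^l η = T^l U η`. So `ψ = U η` is again a
wavelet, with Fourier transform `(1_W + i 1_W ∘ σ) / √2`. Its space `V_j` consists of the `f` whose
transform `F` satisfies `F = i (F ∘ σ)` on `d^m W` for all `m ≥ j`
(`IsWaveletInvolution.mem_spaceV_iff`). Integer translations preserve these conditions when `σ`
moves those points by integers.

Choose `K` with `d K` and `K + d^n` disjoint in `W`, and let `σ` exchange `d^m K` and `d^m (K +
d^n)` by translation, for every `m`. The displacements on `d^m W` are then `0`, `d^(m+n+1)` and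
`-d^(m+n)`. All are integers if `m ≥ -n`, whereas for `m < -n` the last is not, and it occurs on a
set of positive measure. This is the threshold `j ≥ -n`. What remains is an explicit pair `W`, `K`
(`SwapWaveletSet.isWaveletSet`, `SwapWaveletSet.isSwapSet`). -/

lemma norm_fourier_coe (l : ℤ) (x : ℝ) : ‖fourier l (x : UnitAddCircle)‖ = 1 := by
  rw [fourier_apply]; exact Circle.norm_coe _

lemma measurable_fourier_coe (l : ℤ) : Measurable fun x : ℝ => fourier l (x : UnitAddCircle) :=
  (map_continuous (fourier l)).measurable.comp AddCircle.measurable_mk'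

lemma memLp_modulate (l : ℤ) (f : L2R) :
    MemLp (fun x : ℝ => fourier (-l) (x : UnitAddCircle) * f x) 2 volume := by
  refine (Lp.memLp f).of_le
    ((measurable_fourier_coe (-l)).aestronglyMeasurable.mul (Lp.aestronglyMeasurable f)) ?_
  exact Filter.Eventually.of_forall fun x => by rw [norm_mul, norm_fourier_coe, one_mul]

/-- Multiplication by the character `ξ ↦ exp (-2πi l ξ)` on `L²(ℝ)`. -/
def modulation (l : ℤ) : L2R →ₗᵢ[ℂ] L2R where
  toFun f := (memLp_modulate l f).toLp _
  map_add' f g := by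
    apply Lp.ext
    filter_upwards [MemLp.coeFn_toLp (memLp_modulate l (f + g)), Lp.coeFn_add f g,
      MemLp.coeFn_toLp (memLp_modulate l f), MemLp.coeFn_toLp (memLp_modulate l g),
      Lp.coeFn_add ((memLp_modulate l f).toLp _) ((memLp_modulate l g).toLp _)]
      with x h1 h2 h3 h4 h5
    rw [h1, h2, h5, Pi.add_apply, Pi.add_apply, h3, h4, mul_add]
  map_smul' c f := by
    apply Lp.ext
    filter_upwards [MemLp.coeFn_toLp (memLp_modulate l (c • f)), Lp.coeFn_smul c f,
      MemLp.coeFn_toLp (memLp_modulate l f),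
      Lp.coeFn_smul c ((memLp_modulate l f).toLp _)] with x h1 h2 h3 h4
    rw [RingHom.id_apply, h1, h2, h4, Pi.smul_apply, Pi.smul_apply, h3, smul_eq_mul, smul_eq_mul]
    ring
  norm_map' f := by
    change ‖(memLp_modulate l f).toLp _‖ = ‖f‖
    rw [Lp.norm_toLp, Lp.norm_def]
    congr 1
    refine eLpNorm_congr_norm_ae (Filter.Eventually.of_forall fun x => ?_)
    rw [norm_mul, norm_fourier_coe, one_mul]

lemma modulation_coeFn (l : ℤ) (f : L2R) :
    modulation l f =ᵐ[volume] fun x => fourier (-l) (x : UnitAddCircle) * f x :=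
  MemLp.coeFn_toLp (memLp_modulate l f)

/-- The Fourier transform on `L²(ℝ)`. -/
abbrev fourierL2 : L2R ≃ₗᵢ[ℂ] L2R := Lp.fourierTransformₗᵢ ℝ ℂ

lemma fourierL2_toLp (f : 𝓢(ℝ, ℂ)) : fourierL2 (f.toLp 2) = (𝓕 f).toLp 2 :=
  SchwartzMap.toLp_fourier_eq f

lemma eq_of_eq_on_schwartz {A B : L2R → L2R} (hA : Continuous A) (hB : Continuous B)
    (h : ∀ f : 𝓢(ℝ, ℂ), A (f.toLp 2) = B (f.toLp 2)) (f : L2R) : A f = B f := by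
  refine DenseRange.induction_on (p := fun f => A f = B f)
    (SchwartzMap.denseRange_toLpCLM (p := 2) (F := ℂ) (μ := (volume : Measure ℝ))
      ENNReal.ofNat_ne_top) f ?_ h
  exact isClosed_eq hA hB

lemma fourierL2_translation_zpow (l : ℤ) (f : L2R) :
    fourierL2 ((translation ^ l) f) = modulation l (fourierL2 f) := by
  refine eq_of_eq_on_schwartz (A := fun f => fourierL2 ((translation ^ l) f))
    (B := fun f => modulation l (fourierL2 f))
    (fourierL2.continuous.comp (translation ^ l).continuous)
    ((modulation l).continuous.comp fourierL2.continuous) (fun f => ?_) f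
  have h1 : (translation ^ l) (f.toLp 2) = (f.compSubConstCLM ℂ (l : ℝ)).toLp 2 := by
    apply Lp.ext
    refine (translation_zpow_coeFn l _).trans ?_
    refine ((measurePreserving_sub_right volume (l : ℝ)).quasiMeasurePreserving.ae_eq_comp
      (f.coeFn_toLp 2)).trans ?_
    exact ((f.compSubConstCLM ℂ (l : ℝ)).coeFn_toLp 2 volume).symm
  rw [h1, fourierL2_toLp, fourierL2_toLp]
  apply Lp.ext
  refine (SchwartzMap.coeFn_toLp _ 2 volume).trans ?_
  filter_upwards [modulation_coeFn l ((𝓕 f).toLp 2), (𝓕 f).coeFn_toLp 2] with ξ h2 h3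
  rw [h2, h3, fourier_coe, fourier_coe]
  have h4 := congrFun (VectorFourier.fourierIntegral_comp_add_right Real.fourierChar volume
    (innerₗ ℝ) (f : ℝ → ℂ) (-(l : ℝ))) ξ
  have h5 : ((f.compSubConstCLM ℂ (l : ℝ) : 𝓢(ℝ, ℂ)) : ℝ → ℂ)
    = (f : ℝ → ℂ) ∘ fun v => v + -(l : ℝ) := by
    ext x; simp [sub_eq_add_neg]
  rw [h5]
  refine h4.trans ?_
  rw [Circle.smul_def, smul_eq_mul]
  congr 1
  rw [fourier_coe_apply, Real.fourierChar_apply]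
  congr 1
  simp
  ring

lemma fourierL2_dilation (d : ℕ) (hd : 2 ≤ d) (f : L2R) :
    fourierL2 (dilation d hd f) = (dilation d hd)⁻¹ (fourierL2 f) := by
  have hd0 : (0 : ℝ) < d := Nat.cast_pos.2 (Nat.lt_of_lt_of_le Nat.zero_lt_two hd)
  refine eq_of_eq_on_schwartz (A := fun f => fourierL2 (dilation d hd f))
    (B := fun f => (dilation d hd)⁻¹ (fourierL2 f))
    (fourierL2.continuous.comp (dilation d hd).continuous)
    ((dilation d hd)⁻¹.continuous.comp fourierL2.continuous) (fun f => ?_) f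
  set g : 𝓢(ℝ, ℂ) := ((√(d : ℝ) : ℝ) : ℂ) • compCLMOfContinuousLinearEquiv ℂ
    (ContinuousLinearEquiv.unitsEquivAut ℝ (Units.mk0 (d : ℝ) hd0.ne')) f with hg
  have hgx : ∀ x, g x = ((√(d : ℝ) : ℝ) : ℂ) * f (d * x) := fun x => by
    simp [hg, mul_comm x]
  have h1 : dilation d hd (f.toLp 2) = g.toLp 2 := by
    apply Lp.ext
    refine (dilationBy_coeFn hd0 _).trans ?_
    filter_upwards [(quasiMeasurePreserving_mul_left hd0).ae_eq_comp (f.coeFn_toLp 2),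
      g.coeFn_toLp 2] with x h2 h3
    simp only [Function.comp_apply] at h2
    rw [h2, h3, hgx]
  rw [h1, fourierL2_toLp, fourierL2_toLp]
  apply Lp.ext
  refine (SchwartzMap.coeFn_toLp _ 2 volume).trans ?_
  have h2 := dilation_zpow_coeFn d hd (-1) ((𝓕 f).toLp 2)
  rw [zpow_neg_one] at h2
  filter_upwards [h2, (quasiMeasurePreserving_mul_left (zpow_pos hd0 (-1))).ae_eq_comp
    ((𝓕 f).coeFn_toLp 2)] with ξ h3 h4
  simp only [Function.comp_apply] at h4
  rw [h3, h4, fourier_coe, fourier_coe, Real.fourier_real_eq, Real.fourier_real_eq]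
  have h5 := Measure.integral_comp_mul_left
    (fun v => Real.fourierChar (-(v * ((d : ℝ) ^ (-1 : ℤ) * ξ))) • f v) (d : ℝ)
  have h6 : ∀ v : ℝ, Real.fourierChar (-(v * ξ)) • g v = ((√(d : ℝ) : ℝ) : ℂ) *
      (Real.fourierChar (-((d : ℝ) * v * ((d : ℝ) ^ (-1 : ℤ) * ξ))) • f (d * v)) := fun v => by
    rw [hgx, Circle.smul_def, Circle.smul_def, smul_eq_mul, smul_eq_mul]
    have : (d : ℝ) * v * ((d : ℝ) ^ (-1 : ℤ) * ξ) = v * ξ := by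
      rw [zpow_neg_one]; field_simp
    rw [this]; ring
  simp_rw [h6]
  rw [integral_const_mul, h5, abs_of_pos (inv_pos.2 hd0), Complex.real_smul, ← mul_assoc,
    ← Complex.ofReal_mul]
  -- The change of variables contributes `d⁻¹`, and `√d * d⁻¹` is the normalisation of the inverse
  -- dilation.
  congr 2
  rw [zpow_neg_one]
  have := Real.mul_self_sqrt hd0.le
  have hs : √(d : ℝ) ≠ 0 := (Real.sqrt_pos.2 hd0).ne'
  field_simp
  nlinarith

lemma fourierL2_dilation_zpow (d : ℕ) (hd : 2 ≤ d) (m : ℤ) (f : L2R) :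
    fourierL2 ((dilation d hd ^ m) f) = (dilation d hd ^ (-m)) (fourierL2 f) := by
  induction m using Int.induction_on generalizing f with
  | zero => simp
  | succ i ih =>
    rw [zpow_add_one, neg_add, zpow_add, zpow_neg_one]
    exact (ih _).trans (congrArg _ (fourierL2_dilation d hd f))
  | pred i ih =>
    rw [zpow_sub_one, show -(-(i : ℤ) - 1) = - -(i : ℤ) + 1 by ring, zpow_add_one]
    refine (ih _).trans (congrArg _ ?_)
    have h := fourierL2_dilation d hd ((dilation d hd)⁻¹ f)
    have h1 : dilation d hd ((dilation d hd)⁻¹ f) = f := (dilation d hd).apply_symm_apply f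
    rw [h1] at h
    rw [h]
    exact ((dilation d hd).apply_symm_apply _).symm

end

noncomputable section

/-! ### Wavelet sets -/

/-- A measurable set whose integer translates tile `ℝ` and whose `d`-adic dilates tile `ℝ \ {0}`. -/
structure IsWaveletSet (d : ℕ) (W : Set ℝ) : Prop where
  measurableSet : MeasurableSet W
  translation_tiling : ∀ x : ℝ, ∃! k : ℤ, x + k ∈ W
  dilation_tiling : ∀ x : ℝ, x ≠ 0 → ∃! m : ℤ, (d : ℝ) ^ (-m) * x ∈ W

namespace IsWaveletSet

variable {d : ℕ} {W : Set ℝ}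

lemma isAddFundamentalDomain (hW : IsWaveletSet d W) :
    IsAddFundamentalDomain (AddSubgroup.op <| .zmultiples (1 : ℝ)) W volume := by
  refine IsAddFundamentalDomain.mk' hW.measurableSet.nullMeasurableSet fun x => ?_
  have : Function.Bijective
      (Set.codRestrict (fun n : ℤ => n • (1 : ℝ)) (AddSubgroup.zmultiples (1 : ℝ))
        fun n => ⟨n, rfl⟩) :=
    (Equiv.ofInjective (fun n : ℤ => n • (1 : ℝ))
      (zsmul_left_strictMono one_pos).injective).bijective
  refine (AddSubgroup.equivOp _).bijective.comp this |>.existsUnique_iff.2 ?_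
  simpa using! hW.translation_tiling x

lemma measurePreserving_coe (hW : IsWaveletSet d W) :
    MeasurePreserving (β := UnitAddCircle) ((↑) : ℝ → UnitAddCircle) (volume.restrict W) :=
  measurePreserving_quotientAddGroup_mk_of_AddQuotientMeasureEqMeasurePreimage
    volume (𝓕 := W) hW.isAddFundamentalDomain _

lemma volume_eq_one (hW : IsWaveletSet d W) : volume W = 1 := by
  have h := hW.measurePreserving_coe.measure_preimage (MeasurableSet.univ.nullMeasurableSet)
  simpa using h

lemma volume_ne_top (hW : IsWaveletSet d W) : volume W ≠ ⊤ := by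
  simp [hW.volume_eq_one]

lemma integral_fourier (hW : IsWaveletSet d W) (l : ℤ) :
    ∫ x in W, fourier l (x : UnitAddCircle) = if l = 0 then 1 else 0 := by
  have h := integral_map (μ := volume.restrict W) hW.measurePreserving_coe.measurable.aemeasurable
    (f := fun t : UnitAddCircle => fourier l t) (map_continuous (fourier l)).aestronglyMeasurable
  rw [← h, hW.measurePreserving_coe.map_eq]
  have h2 := congrFun (fourierCoeff_fourier (T := 1) l) 0
  rw [fourierCoeff] at h2
  simp only [neg_zero, fourier_zero, one_smul] at h2
  rw [AddCircle.volume_eq_smul_haarAddCircle]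
  simp only [ENNReal.ofReal_one, one_smul]
  rw [h2, Pi.single_apply]
  simp only [eq_comm]

/-- Since `W` is a copy of the circle, this is completeness of the Fourier basis, transported to
`W`. It gives the completeness half of the wavelet property. -/
lemma ae_eq_zero_of_integral_fourier_mul (hW : IsWaveletSet d W) {f : ℝ → ℂ}
    (hf : MemLp f 2 volume) (h : ∀ l : ℤ, ∫ x in W, fourier l (x : UnitAddCircle) * f x = 0) :
    ∀ᵐ x, x ∈ W → f x = 0 := by
  rw [← ae_restrict_iff' hW.measurableSet]
  have hmk := hW.measurePreserving_coe
  obtain ⟨f', hf'm, hff'⟩ := hf.aestronglyMeasurable.aemeasurable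
  have : StandardBorelSpace W := hW.measurableSet.standardBorel
  -- An injective measurable map between standard Borel spaces is an embedding, and injectivity is
  -- the translation tiling. Hence `f` on `W` descends to a measurable `g` on the circle.
  have hemb : MeasurableEmbedding fun x : W => ((x : ℝ) : UnitAddCircle) := by
    refine Measurable.measurableEmbedding (hmk.measurable.comp measurable_subtype_coe) ?_
    intro x y hxy
    obtain ⟨k, hk⟩ := (AddSubgroup.mem_zmultiples_iff).1
      (QuotientAddGroup.eq.1 hxy)
    have hy : (y : ℝ) = x + k := by
      simp only [zsmul_eq_mul, mul_one] at hk
      rw [hk]; ring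
    have := (hW.translation_tiling x).unique (y₁ := k) (y₂ := 0) (hy ▸ y.2)
      (by simp)
    apply Subtype.ext
    rw [hy, this]; simp
  obtain ⟨g, hgm, hg⟩ := hemb.exists_measurable_extend (hf'm.comp measurable_subtype_coe)
    (fun _ => ⟨0⟩)
  have hgf : ∀ᵐ x : ℝ ∂volume.restrict W, g (x : UnitAddCircle) = f x := by
    filter_upwards [ae_restrict_of_ae hff', ae_restrict_mem hW.measurableSet] with x h1 h2
    rw [h1]; exact congrFun hg ⟨x, h2⟩
  have hvol : (volume : Measure UnitAddCircle) = AddCircle.haarAddCircle := by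
    rw [AddCircle.volume_eq_smul_haarAddCircle]; simp
  have hgL : MemLp g 2 (AddCircle.haarAddCircle (T := 1)) := by
    rw [← hvol, ← hmk.map_eq, memLp_map_measure_iff hgm.aestronglyMeasurable
      hmk.measurable.aemeasurable]
    refine (memLp_congr_ae ?_).1 (hf.restrict W)
    filter_upwards [hgf] with x hx using hx.symm
  have hc : ∀ l : ℤ, fourierCoeff g l = 0 := fun l => by
    have hm : Measurable fun t : UnitAddCircle => fourier (-l) t • g t :=
      (map_continuous (fourier (-l))).measurable.smul hgm
    rw [fourierCoeff, ← hvol, ← hmk.map_eq, integral_map hmk.measurable.aemeasurable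
      hm.aestronglyMeasurable, ← h (-l)]
    refine integral_congr_ae ?_
    filter_upwards [hgf] with x hx
    rw [hx, smul_eq_mul]
  have hz : hgL.toLp g = 0 := by
    apply (fourierBasis (T := 1)).repr.injective
    ext l
    rw [fourierBasis_repr, fourierCoeff_congr_ae hgL.coeFn_toLp, hc]
    simp
  have hg0 : g =ᵐ[volume] 0 := by
    rw [hvol]
    exact hgL.coeFn_toLp.symm.trans (hz ▸ Lp.coeFn_zero ..)
  filter_upwards [hgf, hmk.quasiMeasurePreserving.ae hg0] with x h1 h2
  rw [← h1, h2]; rfl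

/-- The function whose Fourier transform is the indicator function of `W`. -/
def wavelet (hW : IsWaveletSet d W) : L2R :=
  fourierL2.symm (indicatorConstLp 2 hW.measurableSet hW.volume_ne_top (1 : ℂ))

lemma fourierL2_translation_wavelet_coeFn (hW : IsWaveletSet d W) (l : ℤ) :
    fourierL2 ((translation ^ l) hW.wavelet) =ᵐ[volume]
      W.indicator fun x => fourier (-l) (x : UnitAddCircle) := by
  rw [fourierL2_translation_zpow, wavelet, LinearIsometryEquiv.apply_symm_apply]
  refine (modulation_coeFn l _).trans ?_
  filter_upwards [indicatorConstLp_coeFn (p := 2) (hs := hW.measurableSet)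
    (hμs := hW.volume_ne_top) (c := (1 : ℂ))] with x hx
  rw [hx]
  by_cases h : x ∈ W <;> simp [h]

lemma fourierL2_affineSystem_wavelet_coeFn (hW : IsWaveletSet d W) (hd : 2 ≤ d) (m l : ℤ) :
    fourierL2 (affineSystem d hd hW.wavelet (m, l)) =ᵐ[volume] fun x =>
      (((√(d : ℝ)) ^ (-m) : ℝ) : ℂ) * W.indicator (fun x => fourier (-l) (x : UnitAddCircle))
        ((d : ℝ) ^ (-m) * x) := by
  have hd0 : (0 : ℝ) < d := Nat.cast_pos.2 (Nat.lt_of_lt_of_le Nat.zero_lt_two hd)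
  rw [affineSystem, fourierL2_dilation_zpow]
  refine (dilation_zpow_coeFn d hd _ _).trans ?_
  filter_upwards [(quasiMeasurePreserving_mul_left (zpow_pos hd0 (-m))).ae_eq_comp
    (hW.fourierL2_translation_wavelet_coeFn l)] with x hx
  simp only [Function.comp_apply] at hx
  rw [hx]

lemma inner_translation_wavelet (hW : IsWaveletSet d W) (l : ℤ) (g : L2R) :
    inner ℂ ((translation ^ l) hW.wavelet) g
      = ∫ x in W, fourier l (x : UnitAddCircle) * fourierL2 g x := by
  rw [← fourierL2.inner_map_map, L2.inner_def, ← integral_indicator hW.measurableSet]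
  refine integral_congr_ae ?_
  filter_upwards [hW.fourierL2_translation_wavelet_coeFn l] with x hx
  rw [hx]
  by_cases h : x ∈ W
  · simp only [h, Set.indicator_of_mem, RCLike.inner_apply, ← fourier_neg, neg_neg]
    ring
  · simp [h]

end IsWaveletSet

/-! ### Orthogonality to a dilation level -/

lemma dilation_zpow_neg_apply (d : ℕ) (hd : 2 ≤ d) (m : ℤ) (g : L2R) :
    (dilation d hd ^ m) ((dilation d hd ^ (-m)) g) = g := by
  change (dilation d hd ^ m * dilation d hd ^ (-m)) g = g
  rw [← zpow_add, add_neg_cancel, zpow_zero]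
  rfl

lemma inner_affineSystem (d : ℕ) (hd : 2 ≤ d) (ψ g : L2R) (m l : ℤ) :
    inner ℂ (affineSystem d hd ψ (m, l)) g
      = inner ℂ ((translation ^ l) ψ) ((dilation d hd ^ (-m)) g) := by
  conv_lhs => rw [← dilation_zpow_neg_apply d hd m g]
  exact (dilation d hd ^ m).inner_map_map _ _

namespace IsWaveletSet

variable {d : ℕ} {W : Set ℝ}

/-- Rescaling reduces to level `0`, where the inner products are Fourier coefficients on `W`.
Combined with the dilation tiling, this yields both orthogonality between levels and completeness,
and later the description of `V_j`. -/
lemma inner_affineSystem_eq_zero_iff (hW : IsWaveletSet d W) (hd : 2 ≤ d) (m : ℤ) (g : L2R) :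
    (∀ l : ℤ, inner ℂ (affineSystem d hd hW.wavelet (m, l)) g = 0) ↔
      ∀ᵐ x, (d : ℝ) ^ (-m) * x ∈ W → fourierL2 g x = 0 := by
  have hd0 : (0 : ℝ) < d := Nat.cast_pos.2 (Nat.lt_of_lt_of_le Nat.zero_lt_two hd)
  have hs0 : √(d : ℝ) ≠ 0 := (Real.sqrt_pos.2 hd0).ne'
  have h1 : fourierL2 ((dilation d hd ^ (-m)) g) =ᵐ[volume]
      fun x => (((√(d : ℝ)) ^ m : ℝ) : ℂ) * fourierL2 g ((d : ℝ) ^ m * x) := by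
    rw [fourierL2_dilation_zpow, neg_neg]
    exact dilation_zpow_coeFn d hd m _
  have hc : (((√(d : ℝ)) ^ m : ℝ) : ℂ) ≠ 0 := Complex.ofReal_ne_zero.2 (zpow_ne_zero _ hs0)
  simp_rw [inner_affineSystem, hW.inner_translation_wavelet]
  constructor
  · intro h
    have h2 := hW.ae_eq_zero_of_integral_fourier_mul (Lp.memLp _) h
    filter_upwards [(quasiMeasurePreserving_mul_left (zpow_pos hd0 (-m))).ae h2,
      (quasiMeasurePreserving_mul_left (zpow_pos hd0 (-m))).ae h1] with x h3 h4 h5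
    have h6 := h3 h5
    rw [h4, ← mul_assoc, ← zpow_add₀ hd0.ne', add_neg_cancel, zpow_zero, one_mul] at h6
    exact (mul_eq_zero.1 h6).resolve_left hc
  · intro h l
    refine setIntegral_eq_zero_of_ae_eq_zero ?_
    filter_upwards [(quasiMeasurePreserving_mul_left (zpow_pos hd0 m)).ae h, h1] with x h3 h4 h5
    rw [h4, h3, mul_zero, mul_zero]
    rwa [← mul_assoc, ← zpow_add₀ hd0.ne', neg_add_cancel, zpow_zero, one_mul]

lemma isWavelet (hW : IsWaveletSet d W) (hd : 2 ≤ d) : IsWavelet d hd hW.wavelet := by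
  constructor
  · rw [orthonormal_iff_ite]
    rintro ⟨m, l⟩ ⟨m', l'⟩
    by_cases hm : m = m'
    · subst hm
      rw [affineSystem, affineSystem, LinearIsometryEquiv.inner_map_map,
        hW.inner_translation_wavelet]
      have : ∫ x in W, fourier l (x : UnitAddCircle) *
          fourierL2 ((translation ^ l') hW.wavelet) x
          = ∫ x in W, fourier (l - l') (x : UnitAddCircle) := by
        refine setIntegral_congr_ae hW.measurableSet ?_
        filter_upwards [hW.fourierL2_translation_wavelet_coeFn l'] with x hx h
        rw [hx, Set.indicator_of_mem h, sub_eq_add_neg, fourier_add]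
      rw [this, hW.integral_fourier]
      simp [sub_eq_zero]
    · rw [if_neg (by simp [hm])]
      refine (hW.inner_affineSystem_eq_zero_iff hd m _).2 ?_ l
      filter_upwards [hW.fourierL2_affineSystem_wavelet_coeFn hd m' l',
        Measure.ae_ne volume (0 : ℝ)] with x h1 h2 h3
      rw [h1, Set.indicator_of_notMem, mul_zero]
      exact fun h4 => hm ((hW.dilation_tiling x h2).unique h3 h4)
  · rw [Submodule.topologicalClosure_eq_top_iff, Submodule.eq_bot_iff]
    intro g hg
    have h1 : ∀ m : ℤ, ∀ᵐ x, (d : ℝ) ^ (-m) * x ∈ W → fourierL2 g x = 0 := fun m =>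
      (hW.inner_affineSystem_eq_zero_iff hd m g).1 fun l =>
        (Submodule.mem_orthogonal _ _).1 hg _ (Submodule.subset_span ⟨_, rfl⟩)
    have h2 : fourierL2 g = 0 := by
      apply Lp.ext
      filter_upwards [ae_all_iff.2 h1, Measure.ae_ne volume (0 : ℝ),
        Lp.coeFn_zero ℂ 2 (volume : Measure ℝ)] with x h3 h4 h5
      obtain ⟨m, hm, -⟩ := hW.dilation_tiling x h4
      rw [h3 m hm, h5]; rfl
    exact (map_eq_zero_iff fourierL2 fourierL2.injective).1 h2

end IsWaveletSet

/-- In an orthonormal basis, the closed span of some of the vectors is the orthogonal complement of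
the others. Orthogonality to levels `m ≥ j` is easier to test on the Fourier side than membership in
a closed span. -/
lemma IsWavelet.mem_spaceV_iff {d : ℕ} {hd : 2 ≤ d} {ψ : L2R} (hψ : IsWavelet d hd ψ) (j : ℤ)
    (f : L2R) :
    f ∈ spaceV d hd ψ j ↔
      ∀ m : ℤ, j ≤ m → ∀ l : ℤ, inner ℂ (affineSystem d hd ψ (m, l)) f = 0 := by
  constructor
  · intro hf m hm l
    have hle : spaceV d hd ψ j ≤ (Submodule.span ℂ {affineSystem d hd ψ (m, l)})ᗮ := by
      refine Submodule.topologicalClosure_minimal _ (Submodule.span_le.2 ?_)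
        (Submodule.isClosed_orthogonal _)
      rintro _ ⟨n, k, hn, rfl⟩
      rw [SetLike.mem_coe, Submodule.mem_orthogonal_singleton_iff_inner_right]
      refine hψ.1.2 fun h => ?_
      have := congrArg Prod.fst h
      simp only at this
      omega
    exact Submodule.mem_orthogonal_singleton_iff_inner_right.1 (hle hf)
  · intro h
    let b := HilbertBasis.mk hψ.1 hψ.2.ge
    have hb := b.hasSum_repr f
    refine (Submodule.isClosed_topologicalClosure _).mem_of_tendsto hb
      (Filter.Eventually.of_forall fun s => Submodule.sum_mem _ fun p _ => ?_)
    obtain ⟨m, l⟩ := p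
    rw [b.repr_apply_apply, HilbertBasis.coe_mk]
    by_cases hm : j ≤ m
    · rw [h m hm l, zero_smul]
      exact Submodule.zero_mem _
    · exact Submodule.smul_mem _ _ (Submodule.le_topologicalClosure _
        (Submodule.subset_span ⟨m, l, not_le.1 hm, rfl⟩))

end

noncomputable section

open Complex

/-! ### Unitary operators built from isometric involutions -/

section Involution

variable {H : Type*} [NormedAddCommGroup H] [InnerProductSpace ℂ H]

lemma inner_involution_left {S : H →ₗᵢ[ℂ] H} (hS : ∀ x, S (S x) = x) (x y : H) :
    inner ℂ (S x) y = inner ℂ x (S y) := by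
  rw [← S.inner_map_map x, hS]

/-- The isometry `(1 + i S) / √2` for an isometric involution `S`. -/
def involutionRotation (S : H →ₗᵢ[ℂ] H) (hS : ∀ x, S (S x) = x) : H →ₗᵢ[ℂ] H where
  toLinearMap := (((√2)⁻¹ : ℝ) : ℂ) • (LinearMap.id + I • S.toLinearMap)
  norm_map' x := by
    change ‖(((√2)⁻¹ : ℝ) : ℂ) • (x + I • S x)‖ = ‖x‖
    -- An isometric involution is symmetric, so the cross term of `x + i S x` is purely imaginary
    -- and drops out of the norm.
    have him : (inner ℂ x (S x)).im = 0 := by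
      have h := inner_involution_left hS x x
      rw [← inner_conj_symm] at h
      exact conj_eq_iff_im.1 h
    have hsq : ‖x + I • S x‖ ^ 2 = 2 * ‖x‖ ^ 2 := by
      rw [@norm_add_sq ℂ, inner_smul_right, norm_smul, norm_I, S.norm_map]
      simp [him]
      ring
    have hn : ‖x + I • S x‖ = √2 * ‖x‖ := by
      rw [← Real.sqrt_sq (norm_nonneg (x + I • S x)), hsq, Real.sqrt_mul (by norm_num),
        Real.sqrt_sq (norm_nonneg x)]
    rw [norm_smul, hn, norm_real, Real.norm_of_nonneg (by positivity), ← mul_assoc,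
      inv_mul_cancel₀ (by positivity), one_mul]

lemma involutionRotation_apply (S : H →ₗᵢ[ℂ] H) (hS : ∀ x, S (S x) = x) (x : H) :
    involutionRotation S hS x = (((√2)⁻¹ : ℝ) : ℂ) • (x + I • S x) := rfl

lemma inner_involutionRotation_eq_zero_iff (S : H →ₗᵢ[ℂ] H) (hS : ∀ x, S (S x) = x) (x y : H) :
    inner ℂ (involutionRotation S hS x) y = 0 ↔ inner ℂ x (y - I • S y) = 0 := by
  have h2 : (((√2)⁻¹ : ℝ) : ℂ) ≠ 0 := ofReal_ne_zero.2 (by positivity)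
  rw [involutionRotation_apply, inner_smul_left, conj_ofReal, mul_eq_zero, or_iff_right h2,
    inner_add_left, inner_smul_left, conj_I, inner_involution_left hS, inner_sub_right,
    inner_smul_right, neg_mul, sub_eq_add_neg]

/-- Applying `S` to `y = i S y` gives `S y = i y`, hence `y = -y`. As `1 - i S` is a multiple of the
adjoint of the rotation, its injectivity carries completeness over to the rotated system. -/
lemma eq_zero_of_sub_involution_eq_zero (S : H →ₗᵢ[ℂ] H) (hS : ∀ x, S (S x) = x) {y : H}
    (h : y - I • S y = 0) : y = 0 := by
  have h1 : y = I • S y := sub_eq_zero.1 h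
  have h2 : S y = I • y := by
    conv_lhs => rw [h1, map_smul, hS]
  rw [h2, smul_smul, I_mul_I, neg_one_smul] at h1
  have h3 : (2 : ℂ) • y = 0 := by
    rw [two_smul]; nth_rewrite 1 [h1]; exact neg_add_cancel y
  exact (smul_eq_zero.1 h3).resolve_left two_ne_zero

lemma mem_orthogonal_span_range_iff {ι : Type*} (v : ι → H) (y : H) :
    y ∈ (Submodule.span ℂ (Set.range v))ᗮ ↔ ∀ i, inner ℂ (v i) y = 0 := by
  refine ⟨fun h i => (Submodule.mem_orthogonal _ _).1 h _ (Submodule.subset_span ⟨i, rfl⟩),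
    fun h => (Submodule.mem_orthogonal' _ _).2 fun u hu => ?_⟩
  have hle : Submodule.span ℂ (Set.range v) ≤ (Submodule.span ℂ {y})ᗮ := by
    refine Submodule.span_le.2 ?_
    rintro _ ⟨i, rfl⟩
    exact Submodule.mem_orthogonal_singleton_iff_inner_left.2 (h i)
  exact Submodule.mem_orthogonal_singleton_iff_inner_right.1 (hle hu)

end Involution

/-! ### Involutions of the line adapted to a wavelet set -/

/-- The line splits into countably many pieces `P c` on which `σ` is translation by `c`. The
involution carries `P c` onto `P (-c)`, so measures can be compared piece by piece. -/
lemma measurePreserving_of_countable_displacement {σ : ℝ → ℝ} (hm : Measurable σ)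
    (hσ : Function.Involutive σ) (hc : (Set.range fun x => σ x - x).Countable) :
    MeasurePreserving σ := by
  refine ⟨hm, Measure.ext fun s hs => ?_⟩
  rw [Measure.map_apply hm hs]
  set C := Set.range fun x => σ x - x
  have : Countable C := hc.to_subtype
  let P : ℝ → Set ℝ := fun c => {x | σ x - x = c}
  have hP : ∀ c, MeasurableSet (P c) := fun c =>
    (hm.sub measurable_id) (measurableSet_singleton c)
  have hPd : ∀ {a b x}, x ∈ P a → x ∈ P b → a = b := fun ha hb => ha.symm.trans hb
  have h1 : ∀ A, MeasurableSet A → volume A = ∑' c : C, volume (A ∩ P c) := fun A hA => by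
    rw [← measure_iUnion (ι := C) (fun a b hab => Set.disjoint_left.2 fun x hx hy =>
      hab (Subtype.ext (hPd hx.2 hy.2))) (fun c => hA.inter (hP c)), ← Set.inter_iUnion,
      Set.inter_eq_left.2]
    exact fun x _ => Set.mem_iUnion.2 ⟨⟨σ x - x, ⟨x, rfl⟩⟩, rfl⟩
  -- The set of displacements is symmetric, since `σ x` is displaced by the opposite of the
  -- displacement of `x`; so the pieces `P (-c)` also cover.
  have h2 : ∀ A, MeasurableSet A → volume A = ∑' c : C, volume (A ∩ P (-c)) := fun A hA => by
    rw [← measure_iUnion (ι := C) (fun a b hab => Set.disjoint_left.2 fun x hx hy =>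
      hab (Subtype.ext (neg_injective (hPd hx.2 hy.2)))) (fun c => hA.inter (hP _)),
      ← Set.inter_iUnion, Set.inter_eq_left.2]
    refine fun x _ => Set.mem_iUnion.2 ⟨⟨x - σ x, ⟨σ x, ?_⟩⟩, ?_⟩
    · simp only [hσ x]
    · simp [P]
  rw [h1 _ (hm hs), h2 s hs]
  refine tsum_congr fun c => ?_
  rw [← measure_preimage_add_right volume (c : ℝ) (s ∩ P (-c))]
  congr 1
  ext x
  simp only [Set.mem_inter_iff, Set.mem_preimage, Set.mem_ofPred_eq, P]
  constructor
  · rintro ⟨hx, hxc⟩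
    have h3 : σ x = x + c := by linarith
    exact ⟨h3 ▸ hx, by rw [← h3, hσ x]; linarith⟩
  · rintro ⟨hx, hxc⟩
    have h3 : σ (x + c) = x := by linarith
    have h4 : σ x = x + c := by rw [← hσ (x + c), h3]
    exact ⟨h4 ▸ hx, by linarith⟩

lemma coe_add_intCast (x : ℝ) (k : ℤ) : ((x + k : ℝ) : UnitAddCircle) = x := by
  rw [AddCircle.coe_add, add_eq_left]
  exact AddCircle.coe_eq_zero_iff _ |>.2 ⟨k, by simp⟩

/-- A measure preserving involution that commutes with multiplication by `d` and moves the points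
of `W` by integers. -/
structure IsWaveletInvolution (d : ℕ) (W : Set ℝ) (σ : ℝ → ℝ) : Prop where
  measurePreserving : MeasurePreserving σ
  involutive : Function.Involutive σ
  map_mul : ∀ x, σ (d * x) = d * σ x
  displacement : ∀ x ∈ W, ∃ k : ℤ, σ x = x + k

namespace IsWaveletInvolution

variable {d : ℕ} {W : Set ℝ} {σ : ℝ → ℝ}

/-- Composition with `σ` on the Fourier side. -/
def operator (h : IsWaveletInvolution d W σ) : L2R →ₗᵢ[ℂ] L2R :=
  fourierL2.symm.toLinearIsometry.comp
    ((Lp.compMeasurePreservingₗᵢ ℂ σ h.measurePreserving).comp fourierL2.toLinearIsometry)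

lemma fourierL2_operator (h : IsWaveletInvolution d W σ) (f : L2R) :
    fourierL2 (h.operator f) = Lp.compMeasurePreservingₗᵢ ℂ σ h.measurePreserving (fourierL2 f) :=
  fourierL2.apply_symm_apply _

lemma fourierL2_operator_coeFn (h : IsWaveletInvolution d W σ) (f : L2R) :
    fourierL2 (h.operator f) =ᵐ[volume] fun x => fourierL2 f (σ x) := by
  rw [h.fourierL2_operator]
  exact Lp.coeFn_compMeasurePreserving _ h.measurePreserving

lemma operator_operator (h : IsWaveletInvolution d W σ) (f : L2R) :
    h.operator (h.operator f) = f := by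
  apply fourierL2.injective
  apply Lp.ext
  refine (h.fourierL2_operator_coeFn _).trans ?_
  filter_upwards [h.measurePreserving.quasiMeasurePreserving.ae (h.fourierL2_operator_coeFn f)]
    with x hx
  rw [hx, h.involutive x]

lemma operator_dilation (h : IsWaveletInvolution d W σ) (hd : 2 ≤ d) (f : L2R) :
    h.operator ((dilation d hd)⁻¹ f) = (dilation d hd)⁻¹ (h.operator f) := by
  have hd0 : (0 : ℝ) < d := Nat.cast_pos.2 (Nat.lt_of_lt_of_le Nat.zero_lt_two hd)
  have hD : ∀ g : L2R, fourierL2 ((dilation d hd)⁻¹ g) = dilation d hd (fourierL2 g) := fun g => by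
    simpa using fourierL2_dilation_zpow d hd (-1) g
  apply fourierL2.injective
  rw [hD]
  apply Lp.ext
  refine (h.fourierL2_operator_coeFn _).trans ?_
  rw [hD]
  filter_upwards [h.measurePreserving.quasiMeasurePreserving.ae
    (dilationBy_coeFn hd0 (fourierL2 f)), dilationBy_coeFn hd0 (fourierL2 (h.operator f)),
    (quasiMeasurePreserving_mul_left hd0).ae (h.fourierL2_operator_coeFn f)] with x h1 h2 h3
  refine h1.trans (Eq.trans ?_ h2.symm)
  rw [h3, h.map_mul]

lemma operator_dilation_zpow (h : IsWaveletInvolution d W σ) (hd : 2 ≤ d) (m : ℤ) (f : L2R) :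
    h.operator ((dilation d hd ^ m) f) = (dilation d hd ^ m) (h.operator f) := by
  induction m using Int.induction_on generalizing f with
  | zero => rfl
  | succ i ih =>
    rw [zpow_add_one]
    refine (ih _).trans (congrArg _ ?_)
    have h1 := h.operator_dilation hd (dilation d hd f)
    have h2 : ∀ g, (dilation d hd)⁻¹ (dilation d hd g) = g := (dilation d hd).symm_apply_apply
    rw [h2] at h1
    rw [h1]
    exact ((dilation d hd).apply_symm_apply _).symm
  | pred i ih =>
    rw [zpow_sub_one]
    exact (ih _).trans (congrArg _ (h.operator_dilation hd f))

/-- Commutation is claimed only on the wavelet of `W`, because `σ` is required to move points by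
integers only on `W`. There the character `exp (-2πi l ξ)` takes the same value at `x` and `σ x`. -/
lemma operator_translation_wavelet (h : IsWaveletInvolution d W σ) (hW : IsWaveletSet d W)
    (l : ℤ) :
    h.operator ((translation ^ l) hW.wavelet) = (translation ^ l) (h.operator hW.wavelet) := by
  apply fourierL2.injective
  apply Lp.ext
  refine (h.fourierL2_operator_coeFn _).trans ?_
  rw [fourierL2_translation_zpow l (h.operator _)]
  have h0 := hW.fourierL2_translation_wavelet_coeFn 0
  rw [zpow_zero] at h0
  change fourierL2 hW.wavelet =ᵐ[volume] _ at h0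
  have hq := h.measurePreserving.quasiMeasurePreserving
  filter_upwards [hq.ae (hW.fourierL2_translation_wavelet_coeFn l), modulation_coeFn l
    (fourierL2 (h.operator hW.wavelet)), h.fourierL2_operator_coeFn hW.wavelet,
    hq.ae h0] with x h1 h2 h3 h4
  rw [h1, h2, h3, h4]
  by_cases hx : σ x ∈ W
  · obtain ⟨k, hk⟩ := h.displacement _ hx
    rw [h.involutive x] at hk
    have hcoe : (x : UnitAddCircle) = (σ x : UnitAddCircle) := by
      conv_lhs => rw [hk, coe_add_intCast]
    simp [hx, hcoe]
  · simp [hx]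

/-- The wavelet obtained by rotating the wavelet of `W` with the involution `σ`. -/
def wavelet (h : IsWaveletInvolution d W σ) (hW : IsWaveletSet d W) : L2R :=
  involutionRotation h.operator h.operator_operator hW.wavelet

lemma affineSystem_wavelet (h : IsWaveletInvolution d W σ) (hW : IsWaveletSet d W) (hd : 2 ≤ d)
    (p : ℤ × ℤ) :
    affineSystem d hd (h.wavelet hW) p
      = involutionRotation h.operator h.operator_operator (affineSystem d hd hW.wavelet p) := by
  rw [affineSystem, affineSystem, wavelet, involutionRotation_apply, involutionRotation_apply,
    h.operator_dilation_zpow, h.operator_translation_wavelet]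
  simp only [map_smul, map_add]

lemma isWavelet (h : IsWaveletInvolution d W σ) (hW : IsWaveletSet d W) (hd : 2 ≤ d) :
    IsWavelet d hd (h.wavelet hW) := by
  have hη := hW.isWavelet hd
  have heq : affineSystem d hd (h.wavelet hW)
      = involutionRotation h.operator h.operator_operator ∘ affineSystem d hd hW.wavelet :=
    funext (h.affineSystem_wavelet hW hd)
  constructor
  · rw [heq]
    exact hη.1.comp_linearIsometry _
  · rw [Submodule.topologicalClosure_eq_top_iff, Submodule.eq_bot_iff]
    intro g hg
    refine eq_zero_of_sub_involution_eq_zero h.operator h.operator_operator ?_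
    have h1 := hη.2
    rw [Submodule.topologicalClosure_eq_top_iff, Submodule.eq_bot_iff] at h1
    refine h1 _ ((mem_orthogonal_span_range_iff _ _).2 fun p => ?_)
    rw [← inner_involutionRotation_eq_zero_iff h.operator h.operator_operator,
      ← h.affineSystem_wavelet hW hd]
    exact (mem_orthogonal_span_range_iff _ _).1 hg p

/-- Moving the rotation to the other side of the inner product, `f` lies in `V_j` exactly when `(1 -
i S) f` is orthogonal to the unrotated levels `m ≥ j`, so its Fourier transform vanishes on `d^m W`.
-/
lemma mem_spaceV_iff (h : IsWaveletInvolution d W σ) (hW : IsWaveletSet d W) (hd : 2 ≤ d) (j : ℤ)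
    (f : L2R) :
    f ∈ spaceV d hd (h.wavelet hW) j ↔ ∀ᵐ x, ∀ m : ℤ, j ≤ m → (d : ℝ) ^ (-m) * x ∈ W →
      fourierL2 f x = I * fourierL2 f (σ x) := by
  have h1 : fourierL2 (f - I • h.operator f) =ᵐ[volume]
      fun x => fourierL2 f x - I * fourierL2 f (σ x) := by
    rw [map_sub, map_smul]
    filter_upwards [Lp.coeFn_sub (fourierL2 f) (I • fourierL2 (h.operator f)),
      Lp.coeFn_smul I (fourierL2 (h.operator f)), h.fourierL2_operator_coeFn f] with x h2 h3 h4
    rw [h2, Pi.sub_apply, h3, Pi.smul_apply, h4, smul_eq_mul]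
  simp_rw [(h.isWavelet hW hd).mem_spaceV_iff, h.affineSystem_wavelet hW,
    inner_involutionRotation_eq_zero_iff, hW.inner_affineSystem_eq_zero_iff hd, ae_all_iff]
  refine forall_congr' fun m => forall_congr' fun _ => Filter.eventually_congr ?_
  filter_upwards [h1] with x hx
  rw [hx, sub_eq_zero]

end IsWaveletInvolution

end

noncomputable section

open Complex

/-! ### Exchanging two pieces of a wavelet set -/

/-- `K` is a set of finite positive measure such that `d K` and `K + dⁿ` are disjoint subsets
of `W`. -/
structure IsSwapSet (d n : ℕ) (W K : Set ℝ) : Prop where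
  measurableSet : MeasurableSet K
  volume_ne_zero : volume K ≠ 0
  volume_ne_top : volume K ≠ ⊤
  pos : ∀ x ∈ K, 0 < x
  mul_mem : ∀ x ∈ K, (d : ℝ) * x ∈ W
  add_mem : ∀ x ∈ K, x + (d : ℝ) ^ n ∈ W
  mul_ne_add : ∀ x ∈ K, ∀ y ∈ K, (d : ℝ) * x ≠ y + (d : ℝ) ^ n

open Classical in
/-- The map that exchanges `dᵐ K` and `dᵐ (K + dⁿ)` by translations, for all integers `m`. -/
def swap (d n : ℕ) (K : Set ℝ) (x : ℝ) : ℝ :=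
  if h : ∃ m : ℤ, (d : ℝ) ^ (-m) * x ∈ K then x + (d : ℝ) ^ (h.choose + n)
  else if h : ∃ m : ℤ, (d : ℝ) ^ (-m) * x - (d : ℝ) ^ n ∈ K then x - (d : ℝ) ^ (h.choose + n)
  else x

lemma swap_of_notMem {d n : ℕ} {K : Set ℝ} {x : ℝ} (h1 : ∀ m : ℤ, (d : ℝ) ^ (-m) * x ∉ K)
    (h2 : ∀ m : ℤ, (d : ℝ) ^ (-m) * x - (d : ℝ) ^ n ∉ K) : swap d n K x = x := by
  rw [swap, dif_neg (not_exists.2 h1), dif_neg (not_exists.2 h2)]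

lemma zpow_neg_mul_zpow_add {D : ℝ} (hD : D ≠ 0) (m : ℤ) (n : ℕ) :
    D ^ (-m) * D ^ (m + n) = D ^ n := by
  rw [← zpow_add₀ hD, neg_add_cancel_left, zpow_natCast]

/-! ### The swap as a wavelet involution, and invariance of its spaces -/

namespace IsSwapSet

variable {d n : ℕ} {W K : Set ℝ}

lemma mem_of_mem (hK : IsSwapSet d n W K) (hd : 2 ≤ d) {m : ℤ} {x : ℝ}
    (h : (d : ℝ) ^ (-m) * x ∈ K) : x ≠ 0 ∧ (d : ℝ) ^ (-(m - 1)) * x ∈ W := by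
  have hd0 : (d : ℝ) ≠ 0 := by positivity
  refine ⟨?_, ?_⟩
  · rintro rfl
    simpa using hK.pos _ h
  · have h1 := hK.mul_mem _ h
    rwa [← mul_assoc, ← zpow_one_add₀ hd0, show 1 + -m = -(m - 1) by ring] at h1

lemma mem_of_sub_mem (hK : IsSwapSet d n W K) {m : ℤ} {x : ℝ}
    (h : (d : ℝ) ^ (-m) * x - (d : ℝ) ^ n ∈ K) : x ≠ 0 ∧ (d : ℝ) ^ (-m) * x ∈ W := by
  refine ⟨?_, ?_⟩
  · rintro rfl
    have h1 := hK.pos _ h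
    have h2 : (0 : ℝ) ≤ (d : ℝ) ^ n := by positivity
    simp only [mul_zero, zero_sub] at h1
    linarith
  · simpa using hK.add_mem _ h

/-- A point of `d^m K` lies in `d^(m-1) W`, and a point of `d^m' (K + d^n)` lies in `d^m' W`. The
dilation tiling forces `m' = m - 1`, against the disjointness of `d K` and `K + d^n`. So the two
branches of `swap` never compete. -/
lemma sub_notMem (hK : IsSwapSet d n W K) (hW : IsWaveletSet d W) (hd : 2 ≤ d) {m m' : ℤ} {x : ℝ}
    (h : (d : ℝ) ^ (-m) * x ∈ K) : (d : ℝ) ^ (-m') * x - (d : ℝ) ^ n ∉ K := fun h' => by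
  have hd0 : (d : ℝ) ≠ 0 := by positivity
  have h1 := hK.mem_of_mem hd h
  have h2 := (hW.dilation_tiling x h1.1).unique h1.2 (hK.mem_of_sub_mem h').2
  subst h2
  refine hK.mul_ne_add _ h _ h' ?_
  rw [← mul_assoc, ← zpow_one_add₀ hd0, show 1 + -m = -(m - 1) by ring]
  ring

lemma swap_of_mem (hK : IsSwapSet d n W K) (hW : IsWaveletSet d W) (hd : 2 ≤ d) {m : ℤ} {x : ℝ}
    (h : (d : ℝ) ^ (-m) * x ∈ K) : swap d n K x = x + (d : ℝ) ^ (m + n) := by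
  have hex : ∃ m : ℤ, (d : ℝ) ^ (-m) * x ∈ K := ⟨m, h⟩
  have h1 := hK.mem_of_mem hd h
  have h2 := (hW.dilation_tiling x h1.1).unique h1.2 (hK.mem_of_mem hd hex.choose_spec).2
  rw [swap, dif_pos hex, show m = hex.choose by linarith]

lemma swap_of_sub_mem (hK : IsSwapSet d n W K) (hW : IsWaveletSet d W) (hd : 2 ≤ d) {m : ℤ}
    {x : ℝ} (h : (d : ℝ) ^ (-m) * x - (d : ℝ) ^ n ∈ K) :
    swap d n K x = x - (d : ℝ) ^ (m + n) := by
  have hex : ∃ m : ℤ, (d : ℝ) ^ (-m) * x - (d : ℝ) ^ n ∈ K := ⟨m, h⟩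
  have h1 := hK.mem_of_sub_mem h
  have h2 := (hW.dilation_tiling x h1.1).unique h1.2 (hK.mem_of_sub_mem hex.choose_spec).2
  rw [swap, dif_neg fun ⟨m', h'⟩ => hK.sub_notMem hW hd h' h, dif_pos hex, ← h2]

lemma swap_mem_of_mem (hK : IsSwapSet d n W K) (hW : IsWaveletSet d W) (hd : 2 ≤ d) {m : ℤ}
    {x : ℝ} (h : (d : ℝ) ^ (-m) * x ∈ K) :
    (d : ℝ) ^ (-m) * swap d n K x - (d : ℝ) ^ n ∈ K := by
  have hd0 : (d : ℝ) ≠ 0 := by positivity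
  rwa [hK.swap_of_mem hW hd h, mul_add, zpow_neg_mul_zpow_add hd0, add_sub_cancel_right]

lemma swap_mem_of_sub_mem (hK : IsSwapSet d n W K) (hW : IsWaveletSet d W) (hd : 2 ≤ d) {m : ℤ}
    {x : ℝ} (h : (d : ℝ) ^ (-m) * x - (d : ℝ) ^ n ∈ K) :
    (d : ℝ) ^ (-m) * swap d n K x ∈ K := by
  have hd0 : (d : ℝ) ≠ 0 := by positivity
  rwa [hK.swap_of_sub_mem hW hd h, mul_sub, zpow_neg_mul_zpow_add hd0]

lemma swap_cases (hK : IsSwapSet d n W K) (hW : IsWaveletSet d W) (hd : 2 ≤ d) (x : ℝ) :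
    (∃ m : ℤ, (d : ℝ) ^ (-m) * x ∈ K ∧ swap d n K x = x + (d : ℝ) ^ (m + n)) ∨
    (∃ m : ℤ, (d : ℝ) ^ (-m) * x - (d : ℝ) ^ n ∈ K ∧ swap d n K x = x - (d : ℝ) ^ (m + n)) ∨
    ((∀ m : ℤ, (d : ℝ) ^ (-m) * x ∉ K) ∧ (∀ m : ℤ, (d : ℝ) ^ (-m) * x - (d : ℝ) ^ n ∉ K) ∧
      swap d n K x = x) := by
  by_cases h1 : ∃ m : ℤ, (d : ℝ) ^ (-m) * x ∈ K
  · obtain ⟨m, hm⟩ := h1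
    exact Or.inl ⟨m, hm, hK.swap_of_mem hW hd hm⟩
  by_cases h2 : ∃ m : ℤ, (d : ℝ) ^ (-m) * x - (d : ℝ) ^ n ∈ K
  · obtain ⟨m, hm⟩ := h2
    exact Or.inr (Or.inl ⟨m, hm, hK.swap_of_sub_mem hW hd hm⟩)
  push Not at h1 h2
  exact Or.inr (Or.inr ⟨h1, h2, swap_of_notMem h1 h2⟩)

lemma swap_involutive (hK : IsSwapSet d n W K) (hW : IsWaveletSet d W) (hd : 2 ≤ d) :
    Function.Involutive (swap d n K) := fun x => by
  rcases hK.swap_cases hW hd x with ⟨m, h1, h2⟩ | ⟨m, h1, h2⟩ | ⟨-, -, h⟩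
  · rw [hK.swap_of_sub_mem hW hd (hK.swap_mem_of_mem hW hd h1), h2, add_sub_cancel_right]
  · rw [hK.swap_of_mem hW hd (hK.swap_mem_of_sub_mem hW hd h1), h2, sub_add_cancel]
  · rw [h, h]

lemma measurable_swap (hK : IsSwapSet d n W K) (hW : IsWaveletSet d W) (hd : 2 ≤ d) :
    Measurable (swap d n K) := by
  let A : ℤ → Set ℝ := fun m => {x | (d : ℝ) ^ (-m) * x ∈ K}
  let B : ℤ → Set ℝ := fun m => {x | (d : ℝ) ^ (-m) * x - (d : ℝ) ^ n ∈ K}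
  have hA : ∀ m, MeasurableSet (A m) := fun m =>
    (measurable_id.const_mul ((d : ℝ) ^ (-m))) hK.measurableSet
  have hB : ∀ m, MeasurableSet (B m) := fun m =>
    ((measurable_id.const_mul ((d : ℝ) ^ (-m))).sub_const ((d : ℝ) ^ n)) hK.measurableSet
  intro s hs
  have : swap d n K ⁻¹' s = (⋃ m, A m ∩ (fun x => x + (d : ℝ) ^ (m + n)) ⁻¹' s) ∪
      (⋃ m, B m ∩ (fun x => x - (d : ℝ) ^ (m + n)) ⁻¹' s) ∪
      (((⋃ m, A m) ∪ ⋃ m, B m)ᶜ ∩ s) := by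
    ext x
    simp only [Set.mem_preimage, Set.mem_union, Set.mem_iUnion, Set.mem_inter_iff, Set.mem_compl_iff,
      not_or, not_exists]
    constructor
    · intro hx
      rcases hK.swap_cases hW hd x with ⟨m, h1, h2⟩ | ⟨m, h1, h2⟩ | ⟨h1, h2, h3⟩
      · exact Or.inl (Or.inl ⟨m, h1, h2 ▸ hx⟩)
      · exact Or.inl (Or.inr ⟨m, h1, h2 ▸ hx⟩)
      · exact Or.inr ⟨⟨h1, h2⟩, h3 ▸ hx⟩
    · rintro ((⟨m, h1, h2⟩ | ⟨m, h1, h2⟩) | ⟨⟨h1, h2⟩, h3⟩)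
      · rwa [hK.swap_of_mem hW hd h1]
      · rwa [hK.swap_of_sub_mem hW hd h1]
      · rwa [swap_of_notMem h1 h2]
  rw [this]
  refine ((MeasurableSet.iUnion fun m => (hA m).inter ((measurable_id.add_const _) hs)).union
    (MeasurableSet.iUnion fun m => (hB m).inter ((measurable_id.sub_const _) hs))).union
    (((MeasurableSet.iUnion hA).union (MeasurableSet.iUnion hB)).compl.inter hs)

lemma isWaveletInvolution (hK : IsSwapSet d n W K) (hW : IsWaveletSet d W) (hd : 2 ≤ d) :
    IsWaveletInvolution d W (swap d n K) where
  measurePreserving := by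
    refine measurePreserving_of_countable_displacement (hK.measurable_swap hW hd)
      (hK.swap_involutive hW hd) ?_
    refine (((Set.countable_range fun m : ℤ => (d : ℝ) ^ (m + n)).union
      (Set.countable_range fun m : ℤ => -(d : ℝ) ^ (m + n))).union
      (Set.countable_singleton 0)).mono ?_
    rintro _ ⟨x, rfl⟩
    rcases hK.swap_cases hW hd x with ⟨m, -, h⟩ | ⟨m, -, h⟩ | ⟨-, -, h⟩
    · exact Or.inl (Or.inl ⟨m, by simp [h]⟩)
    · exact Or.inl (Or.inr ⟨m, by simp [h]⟩)
    · exact Or.inr (by simp [h])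
  involutive := hK.swap_involutive hW hd
  map_mul x := by
    have hd0 : (d : ℝ) ≠ 0 := by positivity
    have h0 : ∀ m : ℤ, (d : ℝ) ^ (-(m + 1)) * (d * x) = (d : ℝ) ^ (-m) * x := fun m => by
      rw [← mul_assoc, ← zpow_add_one₀ hd0]
      congr 2
      ring
    have h0' : ∀ m : ℤ, (d : ℝ) ^ (-m) * (d * x) = (d : ℝ) ^ (-(m - 1)) * x := fun m => by
      rw [← h0 (m - 1), sub_add_cancel]
    have h4 : ∀ m : ℤ, (d : ℝ) ^ (m + 1 + n) = d * (d : ℝ) ^ (m + n) := fun m => by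
      rw [← zpow_one_add₀ hd0]
      congr 1
      ring
    rcases hK.swap_cases hW hd x with ⟨m, h1, h2⟩ | ⟨m, h1, h2⟩ | ⟨h1, h2, h3⟩
    · rw [← h0 m] at h1
      rw [hK.swap_of_mem hW hd h1, h2, h4, mul_add]
    · rw [← h0 m] at h1
      rw [hK.swap_of_sub_mem hW hd h1, h2, h4, mul_sub]
    · rw [h3]
      exact swap_of_notMem (fun m => by rw [h0']; exact h1 _) fun m => by rw [h0']; exact h2 _
  displacement x hx := by
    rcases hK.swap_cases hW hd x with ⟨m, h1, h2⟩ | ⟨m, h1, h2⟩ | ⟨-, -, h⟩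
    · have h3 := hK.mem_of_mem hd h1
      have h4 := (hW.dilation_tiling x h3.1).unique (y₂ := 0) h3.2 (by simpa using hx)
      -- Because it is `d K`, not `K`, that lies in `W`, a point of `W` in this branch has `m = 1`.
      refine ⟨(d : ℤ) ^ (n + 1), ?_⟩
      rw [h2, show m = 1 by linarith, show (1 : ℤ) + n = ((n + 1 : ℕ) : ℤ) by push_cast; ring,
        zpow_natCast]
      simp
    · have h3 := hK.mem_of_sub_mem h1
      have h4 := (hW.dilation_tiling x h3.1).unique (y₂ := 0) h3.2 (by simpa using hx)
      refine ⟨-(d : ℤ) ^ n, ?_⟩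
      rw [h2, h4, zero_add, zpow_natCast]
      simp [sub_eq_add_neg]
    · exact ⟨0, by simp [h]⟩

/-- Outside the spectrum of `V_j`, `j ≥ -n`, the map `swap` moves points by integers. -/
lemma coe_swap (hK : IsSwapSet d n W K) (hW : IsWaveletSet d W) (hd : 2 ≤ d) {m : ℤ} {x : ℝ}
    (hm : -(n : ℤ) ≤ m) (hx : (d : ℝ) ^ (-m) * x ∈ W) :
    (swap d n K x : UnitAddCircle) = x := by
  have key : ∀ i : ℤ, 0 ≤ i + n → ∃ k : ℤ, (d : ℝ) ^ (i + n) = k := fun i hi => by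
    obtain ⟨k, hk⟩ := Int.eq_ofNat_of_zero_le hi
    exact ⟨(d : ℤ) ^ k, by rw [hk, zpow_natCast]; simp⟩
  rcases hK.swap_cases hW hd x with ⟨i, h1, h2⟩ | ⟨i, h1, h2⟩ | ⟨-, -, h⟩
  · have h3 := hK.mem_of_mem hd h1
    have h4 := (hW.dilation_tiling x h3.1).unique h3.2 hx
    obtain ⟨k, hk⟩ := key i (by linarith)
    rw [h2, hk, coe_add_intCast]
  · have h3 := hK.mem_of_sub_mem h1
    have h4 := (hW.dilation_tiling x h3.1).unique h3.2 hx
    obtain ⟨k, hk⟩ := key i (by linarith)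
    rw [h2, hk, sub_eq_add_neg, ← Int.cast_neg, coe_add_intCast]
  · rw [h]

/-- By `coe_swap`, the character takes equal values at `x` and `σ x` wherever a condition is
imposed, so both sides of that condition acquire the same factor. -/
lemma translationInvariant_spaceV (hK : IsSwapSet d n W K) (hW : IsWaveletSet d W) (hd : 2 ≤ d)
    {j : ℤ} (hj : -(n : ℤ) ≤ j) :
    TranslationInvariant (spaceV d hd ((hK.isWaveletInvolution hW hd).wavelet hW) j) := by
  intro l f hf
  have hσ := hK.isWaveletInvolution hW hd
  rw [hσ.mem_spaceV_iff hW hd] at hf ⊢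
  rw [fourierL2_translation_zpow]
  filter_upwards [hf, modulation_coeFn l (fourierL2 f),
    hσ.measurePreserving.quasiMeasurePreserving.ae (modulation_coeFn l (fourierL2 f))]
    with x h1 h2 h3 m hm hx
  rw [h2, h3, h1 m hm hx, hK.coe_swap hW hd (hj.trans hm) hx]
  ring

lemma zpow_ne_intCast (hd : 2 ≤ d) {i : ℤ} (hi : i < 0) (k : ℤ) : (d : ℝ) ^ i ≠ k := by
  have hd1 : (1 : ℝ) < d := by exact_mod_cast hd
  intro h
  have h1 : (0 : ℝ) < (d : ℝ) ^ i := zpow_pos (by linarith) i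
  have h2 : (d : ℝ) ^ i < 1 := zpow_lt_one_of_neg₀ hd1 hi
  rw [h] at h1 h2
  have h3 : 0 < k := by exact_mod_cast h1
  have h4 : k < 1 := by exact_mod_cast h2
  omega

/-- The witness lives on one exchanged pair at level `j`, whose displacement `d^(j+n)` lies strictly
between `0` and `1`; a single translation by `1` takes it out of `V_j`. -/
lemma not_translationInvariant_spaceV (hK : IsSwapSet d n W K) (hW : IsWaveletSet d W)
    (hd : 2 ≤ d) {j : ℤ} (hj : j < -(n : ℤ)) :
    ¬ TranslationInvariant (spaceV d hd ((hK.isWaveletInvolution hW hd).wavelet hW) j) := by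
  intro hT
  have hσ := hK.isWaveletInvolution hW hd
  have hd0 : (0 : ℝ) < d := by positivity
  have hp : (0 : ℝ) < (d : ℝ) ^ (-j) := zpow_pos hd0 _
  set A : Set ℝ := (fun x => (d : ℝ) ^ (-j) * x) ⁻¹' K with hA
  set B : Set ℝ := (fun x => (d : ℝ) ^ (-j) * x - (d : ℝ) ^ n) ⁻¹' K with hB
  have hAm : MeasurableSet A := (measurable_id.const_mul ((d : ℝ) ^ (-j))) hK.measurableSet
  have hBm : MeasurableSet B :=
    ((measurable_id.const_mul ((d : ℝ) ^ (-j))).sub_const ((d : ℝ) ^ n)) hK.measurableSet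
  have hBA : B = (fun x => (d : ℝ) ^ (-j) * x) ⁻¹' ((fun x => x - (d : ℝ) ^ n) ⁻¹' K) := rfl
  have hAv : volume A ≠ ⊤ := by
    rw [hA, Real.volume_preimage_mul_left hp.ne']
    exact ENNReal.mul_ne_top ENNReal.ofReal_ne_top hK.volume_ne_top
  have hBv : volume B = ENNReal.ofReal |((d : ℝ) ^ (-j))⁻¹| * volume K := by
    rw [hBA, Real.volume_preimage_mul_left hp.ne']
    congr 1
    exact (measurePreserving_sub_right volume ((d : ℝ) ^ n)).measure_preimage
      hK.measurableSet.nullMeasurableSet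
  have hBv' : volume B ≠ ⊤ := by
    rw [hBv]
    exact ENNReal.mul_ne_top ENNReal.ofReal_ne_top hK.volume_ne_top
  have hB0 : volume B ≠ 0 := by
    rw [hBv]
    refine mul_ne_zero ?_ hK.volume_ne_zero
    simpa using zpow_pos hd0 _
  -- The values `1` on `A = d^j K` and `i` on `B = d^j (K + d^n)` are chosen so that `F = i (F ∘ σ)`
  -- on `B`.
  set F : L2R := indicatorConstLp 2 hAm hAv (1 : ℂ) + indicatorConstLp 2 hBm hBv' I with hF
  have hFx : F =ᵐ[volume] fun x => A.indicator (fun _ => (1 : ℂ)) x + B.indicator (fun _ => I) x := by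
    filter_upwards [Lp.coeFn_add (indicatorConstLp 2 hAm hAv (1 : ℂ))
      (indicatorConstLp 2 hBm hBv' I), indicatorConstLp_coeFn (p := 2) (hs := hAm) (hμs := hAv)
      (c := (1 : ℂ)), indicatorConstLp_coeFn (p := 2) (hs := hBm) (hμs := hBv') (c := I)]
      with x h1 h2 h3
    rw [h1, Pi.add_apply, h2, h3]
  have hFσ := hσ.measurePreserving.quasiMeasurePreserving.ae hFx
  have hmem : fourierL2.symm F ∈ spaceV d hd (hσ.wavelet hW) j := by
    rw [hσ.mem_spaceV_iff hW hd, fourierL2.apply_symm_apply]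
    filter_upwards [hFx, hFσ] with x h1 h2 m hm hx
    rw [h1, h2]
    -- `A` lies in `d^(j-1) W`, one level below `j`, so no condition is imposed on it. This matters:
    -- the relation fails on `A`, where it would read `1 = i * i`.
    have hxA : x ∉ A := fun h => by
      have h3 := hK.mem_of_mem hd h
      have h4 := (hW.dilation_tiling x h3.1).unique h3.2 hx
      omega
    by_cases hxB : x ∈ B
    · have h3 : swap d n K x ∈ A := hK.swap_mem_of_sub_mem hW hd hxB
      have h4 : swap d n K x ∉ B := hK.sub_notMem hW hd h3
      simp [hxA, hxB, h3, h4]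
    · have h3 : swap d n K x ∉ A := fun h => hxB <| by
        have := hK.swap_mem_of_mem hW hd h
        rwa [hσ.involutive x] at this
      have h4 : swap d n K x ∉ B := fun h => hxA <| by
        have := hK.swap_mem_of_sub_mem hW hd h
        rwa [hσ.involutive x] at this
      simp [hxA, hxB, h3, h4]
  have h1 := hT 1 _ hmem
  rw [hσ.mem_spaceV_iff hW hd, fourierL2_translation_zpow, fourierL2.apply_symm_apply] at h1
  refine hB0 (measure_eq_zero_iff_ae_notMem.2 ?_)
  filter_upwards [h1, hFx, hFσ, modulation_coeFn 1 F,
    hσ.measurePreserving.quasiMeasurePreserving.ae (modulation_coeFn 1 F)] with x h2 h3 h4 h5 h6 hxB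
  have hxA : x ∉ A := fun h => hK.sub_notMem hW hd h hxB
  have hsA : swap d n K x ∈ A := hK.swap_mem_of_sub_mem hW hd hxB
  have hsB : swap d n K x ∉ B := hK.sub_notMem hW hd hsA
  -- On `B` the condition for the translated function says that the character agrees at `x` and `σ
  -- x`, so `d^(j+n)` would be an integer.
  have h7 := h2 j le_rfl (hK.mem_of_sub_mem hxB).2
  rw [h5, h6, h3, h4] at h7
  simp only [hxA, hxB, hsA, hsB, not_false_eq_true, Set.indicator_of_notMem,
    Set.indicator_of_mem, zero_add, add_zero, mul_one, mul_comm _ I] at h7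
  have h8 : AddCircle.toCircle ((-1 : ℤ) • (x : UnitAddCircle))
      = AddCircle.toCircle ((-1 : ℤ) • (swap d n K x : UnitAddCircle)) :=
    Circle.ext (mul_left_cancel₀ I_ne_zero h7)
  rw [(AddCircle.injective_toCircle one_ne_zero).eq_iff, neg_one_zsmul, neg_one_zsmul, neg_inj,
    hK.swap_of_sub_mem hW hd hxB, AddCircle.coe_sub, eq_comm, sub_eq_self,
    AddCircle.coe_eq_zero_iff] at h8
  obtain ⟨k, hk⟩ := h8
  refine zpow_ne_intCast hd (i := j + n) (by omega) k ?_
  rw [← hk]; simp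

end IsSwapSet

end

noncomputable section

/-! ### A wavelet set with a swap set -/

namespace SwapWaveletSet

variable (d n : ℕ)

/-- The interval `[1/d², 1/d)`. -/
def posPart : Set ℝ := {x | 1 ≤ (d : ℝ) ^ 2 * x ∧ d * x < 1}

/-- The interval `[-1/d, -1/d²)`. -/
def negPart : Set ℝ := {x | -1 ≤ (d : ℝ) * x ∧ (d : ℝ) ^ 2 * x < -1}

/-- The points of `[0, 1)` that are not congruent modulo `1` to a point of `posPart` or
`negPart`. -/
def base : Set ℝ := {x | (0 ≤ x ∧ x < 1) ∧ x ∉ posPart d ∧ x - 1 ∉ negPart d}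

/-- The affine map `x ↦ dⁿ (d² x - 1)`, which maps a part of `posPart` onto `[0, 1)`. -/
def expand (x : ℝ) : ℝ := (d : ℝ) ^ n * ((d : ℝ) ^ 2 * x - 1)

/-- The points whose orbit under `expand` meets `base`. -/
def core : Set ℝ := {x | ∃ i : ℕ, (expand d n)^[i] x ∈ base d}

/-- The wavelet set. -/
def waveletSet : Set ℝ :=
  {x | x - (d : ℝ) ^ n ∈ core d n ∨ x ∈ negPart d ∨ (x ∈ posPart d ∧ expand d n x ∉ core d n)}

/-- The swap set. -/
def swapSet : Set ℝ := Set.Ico ((1 + 1 / (d : ℝ) ^ n) / (d : ℝ) ^ 3) (1 / (d : ℝ) ^ 2)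

variable {d n}

lemma measurableSet_posPart : MeasurableSet (posPart d) :=
  (measurableSet_le measurable_const (measurable_id.const_mul _)).inter
    (measurableSet_lt (measurable_id.const_mul _) measurable_const)

lemma measurableSet_negPart : MeasurableSet (negPart d) :=
  (measurableSet_le measurable_const (measurable_id.const_mul _)).inter
    (measurableSet_lt (measurable_id.const_mul _) measurable_const)

lemma measurableSet_base : MeasurableSet (base d) :=
  ((measurableSet_le measurable_const measurable_id).inter
    (measurableSet_lt measurable_id measurable_const)).inter
    (measurableSet_posPart.compl.inter ((measurable_id.sub_const 1) measurableSet_negPart).compl)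

lemma measurable_expand : Measurable (expand d n) :=
  ((measurable_id.const_mul _).sub_const _).const_mul _

lemma measurableSet_core : MeasurableSet (core d n) := by
  have : core d n = ⋃ i : ℕ, ((expand d n)^[i]) ⁻¹' base d := by
    ext x; simp [core]
  rw [this]
  exact MeasurableSet.iUnion fun i => (measurable_expand.iterate i) measurableSet_base

lemma measurableSet_waveletSet : MeasurableSet (waveletSet d n) :=
  ((measurable_id.sub_const _) measurableSet_core).union (measurableSet_negPart.union
    (measurableSet_posPart.inter (measurable_expand measurableSet_core).compl))

lemma mem_core_iff {x : ℝ} : x ∈ core d n ↔ x ∈ base d ∨ expand d n x ∈ core d n := by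
  constructor
  · rintro ⟨i, hi⟩
    cases i with
    | zero => exact Or.inl hi
    | succ i => exact Or.inr ⟨i, hi⟩
  · rintro (h | ⟨i, hi⟩)
    · exact ⟨0, h⟩
    · exact ⟨i + 1, hi⟩

/-! ### Location of the pieces and the translation tiling -/

lemma two_le_cast (hd : 2 ≤ d) : (2 : ℝ) ≤ d := by exact_mod_cast hd

lemma one_le_cast_pow (hd : 2 ≤ d) (n : ℕ) : (1 : ℝ) ≤ (d : ℝ) ^ n :=
  one_le_pow₀ (by linarith [two_le_cast hd])

lemma mem_Ioo_of_mem_posPart (hd : 2 ≤ d) {x : ℝ} (hx : x ∈ posPart d) : 0 < x ∧ x < 1 := by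
  have hD := two_le_cast hd
  obtain ⟨h1, h2⟩ := hx
  have h3 : 0 < x := pos_of_mul_pos_right (by linarith) (by positivity : (0 : ℝ) ≤ (d : ℝ) ^ 2)
  exact ⟨h3, by nlinarith⟩

lemma mem_Ioo_of_mem_negPart (hd : 2 ≤ d) {x : ℝ} (hx : x ∈ negPart d) : -1 < x ∧ x < 0 := by
  have hD := two_le_cast hd
  obtain ⟨h1, h2⟩ := hx
  have h3 : x < 0 := by
    by_contra h
    have : 0 ≤ (d : ℝ) ^ 2 * x := mul_nonneg (by positivity) (not_lt.1 h)
    linarith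
  exact ⟨by nlinarith, h3⟩

lemma sub_one_notMem_negPart (hd : 2 ≤ d) {x : ℝ} (hx : d * x < 1) : x - 1 ∉ negPart d := by
  have hD := two_le_cast hd
  rintro ⟨h1, -⟩
  linarith

lemma mem_posPart_of_expand (hd : 2 ≤ d) {x : ℝ} (h0 : 0 ≤ expand d n x) (h1 : expand d n x < 1) :
    x ∈ posPart d := by
  have hD := two_le_cast hd
  have hN := one_le_cast_pow hd n
  have h2 : 0 ≤ (d : ℝ) ^ 2 * x - 1 := nonneg_of_mul_nonneg_right h0 (by linarith)
  have h3 : (d : ℝ) ^ 2 * x - 1 < 1 := lt_of_le_of_lt (le_mul_of_one_le_left h2 hN) h1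
  exact ⟨by linarith, by nlinarith⟩

lemma core_subset (hd : 2 ≤ d) {x : ℝ} (hx : x ∈ core d n) : 0 ≤ x ∧ x < 1 := by
  obtain ⟨i, hi⟩ := hx
  induction i generalizing x with
  | zero => exact hi.1
  | succ i ih =>
    have h1 := ih hi
    have h2 := mem_Ioo_of_mem_posPart hd (mem_posPart_of_expand hd h1.1 h1.2)
    exact ⟨h2.1.le, h2.2⟩

lemma expand_mem_core {x : ℝ} (hx : x ∈ core d n) (hx' : x ∈ posPart d) :
    expand d n x ∈ core d n :=
  (mem_core_iff.1 hx).resolve_left fun h => h.2.1 hx'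

lemma sub_one_notMem_negPart_of_mem_core (hd : 2 ≤ d) {x : ℝ} (hx : x ∈ core d n) :
    x - 1 ∉ negPart d := by
  rcases mem_core_iff.1 hx with h | h
  · exact h.2.2
  · have h1 := core_subset hd h
    exact sub_one_notMem_negPart hd (mem_posPart_of_expand hd h1.1 h1.2).2

/-- `posPart` and `negPart` already tile under dilation but leave the residues in `base` uncovered.
Adding `base + d^n` covers these, but duplicates dilates of the part of `posPart` that `expand`
sends to `base`. Removing that part uncovers its residues in turn, and `core` is what results from
iterating. Thus the shift is `d^n` on `core`; off it, `0` on `posPart` and `-1` elsewhere. -/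
lemma existsUnique_add_mem_of_mem_Ico (hd : 2 ≤ d) {x : ℝ} (h0 : 0 ≤ x) (h1 : x < 1) :
    ∃! k : ℤ, x + k ∈ waveletSet d n := by
  have hcore : ∀ k : ℤ, x + k - (d : ℝ) ^ n ∈ core d n → k = (d : ℤ) ^ n := fun k hk => by
    obtain ⟨h2, h3⟩ := core_subset hd hk
    have h4 : (k : ℝ) - (d : ℝ) ^ n < 1 := by linarith
    have h5 : (-1 : ℝ) < (k : ℝ) - (d : ℝ) ^ n := by linarith
    have h6 : k - (d : ℤ) ^ n < 1 := by exact_mod_cast h4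
    have h7 : -1 < k - (d : ℤ) ^ n := by exact_mod_cast h5
    omega
  have hneg : ∀ k : ℤ, x + k ∈ negPart d → k = -1 := fun k hk => by
    obtain ⟨h2, h3⟩ := mem_Ioo_of_mem_negPart hd hk
    have h4 : (k : ℝ) < 0 := by linarith
    have h5 : (-2 : ℝ) < k := by linarith
    have h6 : k < 0 := by exact_mod_cast h4
    have h7 : -2 < k := by exact_mod_cast h5
    omega
  have hpos : ∀ k : ℤ, x + k ∈ posPart d → k = 0 := fun k hk => by
    obtain ⟨h2, h3⟩ := mem_Ioo_of_mem_posPart hd hk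
    have h4 : (k : ℝ) < 1 := by linarith
    have h5 : (-1 : ℝ) < k := by linarith
    have h6 : k < 1 := by exact_mod_cast h4
    have h7 : -1 < k := by exact_mod_cast h5
    omega
  by_cases hx : x ∈ core d n
  · refine ⟨(d : ℤ) ^ n, Or.inl (by simpa using hx), ?_⟩
    rintro k (hk | hk | ⟨hk, hk'⟩)
    · exact hcore k hk
    · rw [hneg k hk] at hk
      exact absurd (by simpa [sub_eq_add_neg] using hk) (sub_one_notMem_negPart_of_mem_core hd hx)
    · have h2 := hpos k hk
      rw [h2, Int.cast_zero, add_zero] at hk hk'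
      exact absurd (expand_mem_core hx hk) hk'
  · have hx' := hx
    rw [mem_core_iff, not_or] at hx'
    by_cases hp : x ∈ posPart d
    · refine ⟨0, Or.inr (Or.inr (by simpa using ⟨hp, hx'.2⟩)), ?_⟩
      rintro k (hk | hk | ⟨hk, -⟩)
      · rw [hcore k hk] at hk
        exact absurd (by simpa using hk) hx
      · rw [hneg k hk] at hk
        exact absurd (by simpa [sub_eq_add_neg] using hk) (sub_one_notMem_negPart hd hp.2)
      · exact hpos k hk
    · have hn : x - 1 ∈ negPart d := by
        by_contra hn
        exact hx'.1 ⟨⟨h0, h1⟩, hp, hn⟩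
      refine ⟨-1, Or.inr (Or.inl (by simpa [sub_eq_add_neg] using hn)), ?_⟩
      rintro k (hk | hk | ⟨hk, -⟩)
      · rw [hcore k hk] at hk
        exact absurd (by simpa using hk) hx
      · exact hneg k hk
      · rw [hpos k hk] at hk
        exact absurd (by simpa using hk) hp

/-! ### The dilation tiling -/

lemma zpow_neg_mul_mem_posPart_iff (hd : 2 ≤ d) (m : ℤ) (x : ℝ) :
    (d : ℝ) ^ (-m) * x ∈ posPart d ↔ (d : ℝ) ^ (m - 2) ≤ x ∧ x < (d : ℝ) ^ (m - 1) := by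
  have hd0 : (0 : ℝ) < d := by linarith [two_le_cast hd]
  have h1 : (d : ℝ) ^ 2 * ((d : ℝ) ^ (-m) * x) = x / (d : ℝ) ^ (m - 2) := by
    rw [zpow_sub₀ hd0.ne', zpow_neg]; field_simp
  have h2 : (d : ℝ) * ((d : ℝ) ^ (-m) * x) = x / (d : ℝ) ^ (m - 1) := by
    rw [zpow_sub₀ hd0.ne', zpow_neg, zpow_one]; field_simp
  change 1 ≤ _ ∧ _ < 1 ↔ _
  rw [h1, h2, one_le_div (zpow_pos hd0 _), div_lt_one (zpow_pos hd0 _)]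

lemma zpow_neg_mul_mem_negPart_iff (hd : 2 ≤ d) (m : ℤ) (x : ℝ) :
    (d : ℝ) ^ (-m) * x ∈ negPart d ↔ (d : ℝ) ^ (m - 2) < -x ∧ -x ≤ (d : ℝ) ^ (m - 1) := by
  have hd0 : (0 : ℝ) < d := by linarith [two_le_cast hd]
  have h1 : (d : ℝ) ^ 2 * ((d : ℝ) ^ (-m) * x) = x / (d : ℝ) ^ (m - 2) := by
    rw [zpow_sub₀ hd0.ne', zpow_neg]; field_simp
  have h2 : (d : ℝ) * ((d : ℝ) ^ (-m) * x) = x / (d : ℝ) ^ (m - 1) := by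
    rw [zpow_sub₀ hd0.ne', zpow_neg, zpow_one]; field_simp
  change -1 ≤ _ ∧ _ < -1 ↔ _
  rw [h1, h2, le_div_iff₀ (zpow_pos hd0 _), div_lt_iff₀ (zpow_pos hd0 _), and_comm]
  constructor <;> rintro ⟨h3, h4⟩ <;> constructor <;> linarith

lemma existsUnique_mem_posPart (hd : 2 ≤ d) {x : ℝ} (hx : 0 < x) :
    ∃! m : ℤ, (d : ℝ) ^ (-m) * x ∈ posPart d := by
  have hd1 : (1 : ℝ) < d := by linarith [two_le_cast hd]
  simp_rw [zpow_neg_mul_mem_posPart_iff hd]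
  obtain ⟨i, hi1, hi2⟩ := exists_mem_Ico_zpow hx hd1
  refine ⟨i + 2, ⟨by simpa using hi1, by rwa [show i + 2 - 1 = i + 1 by ring]⟩, ?_⟩
  rintro k ⟨hk1, hk2⟩
  have h1 := (zpow_lt_zpow_iff_right₀ hd1).1 (hk1.trans_lt hi2)
  have h2 := (zpow_lt_zpow_iff_right₀ hd1).1 (hi1.trans_lt hk2)
  omega

lemma existsUnique_mem_negPart (hd : 2 ≤ d) {x : ℝ} (hx : x < 0) :
    ∃! m : ℤ, (d : ℝ) ^ (-m) * x ∈ negPart d := by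
  have hd1 : (1 : ℝ) < d := by linarith [two_le_cast hd]
  simp_rw [zpow_neg_mul_mem_negPart_iff hd]
  obtain ⟨i, hi1, hi2⟩ := exists_mem_Ioc_zpow (neg_pos.2 hx) hd1
  refine ⟨i + 2, ⟨by simpa using hi1, by rwa [show i + 2 - 1 = i + 1 by ring]⟩, ?_⟩
  rintro k ⟨hk1, hk2⟩
  have h1 := (zpow_lt_zpow_iff_right₀ hd1).1 (hk1.trans_le hi2)
  have h2 := (zpow_lt_zpow_iff_right₀ hd1).1 (hi1.trans_le hk2)
  omega

/-- This is the exchange behind the dilation tiling: hitting `core + d^n` at level `m` is the same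
as hitting the removed part of `posPart` at level `m + n + 2`. -/
lemma expand_zpow_neg_mul (hd : 2 ≤ d) (m : ℤ) (x : ℝ) :
    expand d n ((d : ℝ) ^ (-(m + n + 2)) * x) = (d : ℝ) ^ (-m) * x - (d : ℝ) ^ n := by
  have hd0 : (d : ℝ) ≠ 0 := by linarith [two_le_cast hd]
  have h : (d : ℝ) ^ n * (d : ℝ) ^ 2 * (d : ℝ) ^ (-(m + n + 2)) = (d : ℝ) ^ (-m) := by
    rw [← pow_add, ← zpow_natCast, ← zpow_add₀ hd0]
    congr 1
    push_cast
    ring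
  rw [expand, ← h]
  ring

lemma existsUnique_mul_mem (hd : 2 ≤ d) {x : ℝ} (hx : x ≠ 0) :
    ∃! m : ℤ, (d : ℝ) ^ (-m) * x ∈ waveletSet d n := by
  have hd0 : (0 : ℝ) < d := by linarith [two_le_cast hd]
  rcases hx.lt_or_gt with hx | hx
  · obtain ⟨m, hm, huniq⟩ := existsUnique_mem_negPart hd hx
    have hneg : ∀ k : ℤ, (d : ℝ) ^ (-k) * x < 0 := fun k =>
      mul_neg_of_pos_of_neg (zpow_pos hd0 _) hx
    refine ⟨m, Or.inr (Or.inl hm), ?_⟩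
    rintro k (hk | hk | ⟨hk, -⟩)
    · have h1 := (core_subset hd hk).1
      have h2 := one_le_cast_pow hd n
      linarith [hneg k]
    · exact huniq k hk
    · linarith [hneg k, (mem_Ioo_of_mem_posPart hd hk).1]
  · obtain ⟨m, hm, huniq⟩ := existsUnique_mem_posPart hd hx
    have hpos : ∀ k : ℤ, 0 < (d : ℝ) ^ (-k) * x := fun k => mul_pos (zpow_pos hd0 _) hx
    have hcore : ∀ k : ℤ, (d : ℝ) ^ (-k) * x - (d : ℝ) ^ n ∈ core d n → k + n + 2 = m := by
      intro k hk
      rw [← expand_zpow_neg_mul hd] at hk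
      have h1 := core_subset hd hk
      exact huniq _ (mem_posPart_of_expand hd h1.1 h1.2)
    by_cases hc : expand d n ((d : ℝ) ^ (-m) * x) ∈ core d n
    · refine ⟨m - n - 2, Or.inl ?_, ?_⟩
      · rwa [← expand_zpow_neg_mul hd, show m - n - 2 + n + 2 = m by ring]
      · rintro k (hk | hk | ⟨hk, hk'⟩)
        · have := hcore k hk
          omega
        · linarith [hpos k, (mem_Ioo_of_mem_negPart hd hk).2]
        · rw [huniq k hk] at hk'
          exact absurd hc hk'
    · refine ⟨m, Or.inr (Or.inr ⟨hm, hc⟩), ?_⟩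
      rintro k (hk | hk | ⟨hk, -⟩)
      · rw [← hcore k hk, expand_zpow_neg_mul hd] at hc
        exact absurd hk hc
      · linarith [hpos k, (mem_Ioo_of_mem_negPart hd hk).2]
      · exact huniq k hk

lemma isWaveletSet (hd : 2 ≤ d) : IsWaveletSet d (waveletSet d n) where
  measurableSet := measurableSet_waveletSet
  translation_tiling x := by
    obtain ⟨k, hk, huniq⟩ := existsUnique_add_mem_of_mem_Ico (n := n) hd (Int.fract_nonneg x)
      (Int.fract_lt_one x)
    refine ⟨k - ⌊x⌋, ?_, fun k' hk' => ?_⟩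
    · convert hk using 1
      rw [Int.fract]; push_cast; ring
    · rw [← huniq (k' + ⌊x⌋) ?_]
      · ring
      · convert hk' using 1
        rw [Int.fract]; push_cast; ring_nf
  dilation_tiling _ hx := existsUnique_mul_mem hd hx

/-! ### The swap set inside the wavelet set -/

lemma mem_swapSet_iff (hd : 2 ≤ d) {x : ℝ} :
    x ∈ swapSet d n ↔ 1 / (d : ℝ) ^ n ≤ (d : ℝ) ^ 3 * x - 1 ∧ (d : ℝ) ^ 2 * x < 1 := by
  have hd0 : (0 : ℝ) < d := by linarith [two_le_cast hd]
  rw [swapSet, Set.mem_Ico, div_le_iff₀ (by positivity), lt_div_iff₀ (by positivity),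
    le_sub_iff_add_le, add_comm, mul_comm x, mul_comm x]

/-- The left endpoint of `K` is chosen so that `expand ≥ 1` on `d K`, which therefore stays in the
retained part of `posPart`. The right endpoint keeps `K` below `posPart`, so that `K` lies in `base`
and `K + d^n` in `W`. Disjointness holds because `d K` lies below `1` and `K + d^n` above it. -/
lemma isSwapSet (hd : 2 ≤ d) (hn : 1 ≤ n) : IsSwapSet d n (waveletSet d n) (swapSet d n) := by
  have hD := two_le_cast hd
  have hd0 : (0 : ℝ) < d := by linarith
  have hN : (1 : ℝ) ≤ (d : ℝ) ^ n := one_le_cast_pow hd n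
  have hN0 : (0 : ℝ) < 1 / (d : ℝ) ^ n := by positivity
  have hpos : ∀ x ∈ swapSet d n, 0 < x := fun x hx => by
    have h := ((mem_swapSet_iff hd).1 hx).1
    exact pos_of_mul_pos_right (by linarith) (by positivity : (0 : ℝ) ≤ (d : ℝ) ^ 3)
  have hlt : ∀ x ∈ swapSet d n, (d : ℝ) * x < 1 := fun x hx => by
    have h := ((mem_swapSet_iff hd).1 hx).2
    have h1 := mul_pos hd0 (hpos x hx)
    nlinarith
  refine ⟨measurableSet_Ico, ?_, ?_, hpos, fun x hx => ?_, fun x hx => ?_, fun x hx y hy => ?_⟩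
  · rw [swapSet, Real.volume_Ico, Ne, ENNReal.ofReal_eq_zero, not_le, sub_pos,
      div_lt_div_iff₀ (by positivity) (by positivity), one_mul]
    -- Nonemptiness of `K` means `1 + d^(-n) < d`; this is where `n ≥ 1` enters, as it fails for `d
    -- = 2`, `n = 0`.
    have h1 : (2 : ℝ) ≤ (d : ℝ) ^ n := hD.trans (le_self_pow₀ (by linarith) (by omega))
    have h2 : 1 / (d : ℝ) ^ n ≤ 1 / 2 := one_div_le_one_div_of_le (by norm_num) h1
    have h3 : (0 : ℝ) < (d : ℝ) ^ 2 := by positivity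
    nlinarith
  · rw [swapSet, Real.volume_Ico]
    exact ENNReal.ofReal_ne_top
  · obtain ⟨h1, h2⟩ := (mem_swapSet_iff hd).1 hx
    refine Or.inr (Or.inr ⟨⟨?_, ?_⟩, fun h => ?_⟩)
    · nlinarith
    · nlinarith
    · have h3 := (core_subset hd h).2
      rw [expand, show (d : ℝ) ^ 2 * (d * x) = (d : ℝ) ^ 3 * x by ring] at h3
      rw [div_le_iff₀ (by positivity), mul_comm] at h1
      linarith
  · obtain ⟨h1, h2⟩ := (mem_swapSet_iff hd).1 hx
    refine Or.inl (mem_core_iff.2 (Or.inl ?_))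
    rw [add_sub_cancel_right]
    refine ⟨⟨(hpos x hx).le, ?_⟩, fun h => ?_, sub_one_notMem_negPart hd (hlt x hx)⟩
    · nlinarith [hpos x hx, hlt x hx]
    · linarith [h.1]
  · intro h
    linarith [hlt x hx, hpos y hy]

end SwapWaveletSet

end

theorem theorem1 (d : ℕ) (hd : 2 ≤ d) (n : ℕ) (hn : 1 ≤ n) :
    ∃ ψ : L2R, ψ ∈ classM d hd n ∧ HasTranslationInvarianceOrder d hd n ψ := by
  have hW : IsWaveletSet d (SwapWaveletSet.waveletSet d n) := SwapWaveletSet.isWaveletSet hd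
  have hK := SwapWaveletSet.isSwapSet hd hn
  have hσ := hK.isWaveletInvolution hW hd
  have hord : HasTranslationInvarianceOrder d hd n (hσ.wavelet hW) := fun j =>
    ⟨fun h => not_lt.1 fun hj => hK.not_translationInvariant_spaceV hW hd hj h,
      fun hj => hK.translationInvariant_spaceV hW hd hj⟩
  refine ⟨hσ.wavelet hW, ⟨⟨hσ.isWavelet hW hd, (hord _).2 le_rfl⟩, fun h => ?_⟩, hord⟩
  have h1 := (hord _).1 h.2
  push_cast at h1
  linarith
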